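/- Let $\alpha<-3/\sqrt[3]{4}$, put $f(v,\alpha)=v^3-\alpha v^2-1$, and consider the planar system $$\frac{dv}{d\tau}=v f(v,\alpha)+z^2,\qquad \frac{dz}{d\tau}=z f(v,\alpha).$$ The polynomial $f(\cdot,\alpha)$ has exactly three real roots $v_1^0<v_2^0<0<v_3^0$, and $P_1=(v_1^0,0)$ and $P_3=(v_3^0,0)$ are saddle equilibria. Let $L^-$ be the unstable separatrix of $P_1$ in the upper half plane (the set of points with $z>0$ whose solution tends to $P_1$ as $\tau\to-\infty$), and let $L^+$ be the stable separatrix of $P_3$ in the upper half plane (the set of points with $z>0$ whose solution tends to $P_3$ as $\tau\to+\infty$). Put $$\mathcal D_2=\{(v,z): z>0,\ v_1^0<v<v_2^0,\ vf(v,\alpha)+z^2>0\},\qquad \mathcal D_3=\{(v,z): z>0,\ v_2^0\le v<v_3^0,\ vf(v,\alpha)+z^2>0\}.$$ For a point $p$ with solution $(v(\tau),z(\tau))$, $(v(0),z(0))=p$, defined on its maximal existence interval, let $\overline\tau(p)$ be the supremum of the times $\tau>0$ in that interval such that $vf(v,\alpha)+z^2>0$ along the solution on $[0,\tau]$, and let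 $\underline\tau(p)$ be the infimum of the times $\tau<0$ in that interval such that $vf(v,\alpha)+z^2>0$ along the solution on $[\tau,0]$. Define $$v^-(\alpha)=\lim_{\tau\to\overline\tau(p)^-}v(\tau)\quad\text{for } p\in\mathcal D_2\cap L^-,\qquad v^+(\alpha)=\lim_{\tau\to\underline\tau(p)^+}v(\tau)\quad\text{for } p\in\mathcal D_3\cap L^+,$$ limits being taken in $[-\infty,+\infty]$. Then $\mathcal D_2\cap L^-$ and $\mathcal D_3\cap L^+$ are nonempty, $v^-(\alpha)$ and $v^+(\alpha)$ exist and do not depend on the choice of $p$, and exactly one of the following four cases holds: (i) $v^-(\alpha)=0$ and $v^+(\alpha)=-\infty$; (ii) $0<v^-(\alpha)<v_3^0$ and $v^+(\alpha)=-\infty$; (iii) $v^-(\alpha)=v_3^0$ and $v^+(\alpha)=v_1^0$; (iv) $v^-(\alpha)=+\infty$ and $v_1^0<v^+(\alpha)<v_2^0$. -/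

import Mathlib

open Set Filter Topology

noncomputable section

namespace PoincareSystem

/-- `f(v, α) = v³ - α v² - 1`. -/
def f (v α : ℝ) : ℝ := v ^ 3 - α * v ^ 2 - 1

/-- The planar vector field `(v, z) ↦ (v f(v, α) + z², z f(v, α))`. -/
def field (α : ℝ) (p : ℝ × ℝ) : ℝ × ℝ :=
  (p.1 * f p.1 α + p.2 ^ 2, p.2 * f p.1 α)

/-- The set of real roots of `v ↦ f(v, α)`; it has exactly three elements when `α < -3/∛4`. -/
def roots (α : ℝ) : Set ℝ := {v | f v α = 0}

/-- The smallest root `v₁⁰(α)`. -/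
def v1 (α : ℝ) : ℝ := sInf (roots α)

/-- The largest root `v₃⁰(α)`. -/
def v3 (α : ℝ) : ℝ := sSup (roots α)

/-- The second largest root `v₂⁰(α)`. -/
def v2 (α : ℝ) : ℝ := sSup (roots α \ {v3 α})

/-- The equilibrium `P₁(α)`. -/
def P1 (α : ℝ) : ℝ × ℝ := (v1 α, 0)

/-- The equilibrium `P₃(α)`. -/
def P3 (α : ℝ) : ℝ × ℝ := (v3 α, 0)

/-- The domain `𝒟₂(α)` of the upper half plane. -/
def D2 (α : ℝ) : Set (ℝ × ℝ) :=
  {p | 0 < p.2 ∧ v1 α < p.1 ∧ p.1 < v2 α ∧ 0 < p.1 * f p.1 α + p.2 ^ 2}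

/-- The domain `𝒟₃(α)` of the upper half plane. -/
def D3 (α : ℝ) : Set (ℝ × ℝ) :=
  {p | 0 < p.2 ∧ v2 α ≤ p.1 ∧ p.1 < v3 α ∧ 0 < p.1 * f p.1 α + p.2 ^ 2}

/-- The maximal existence interval of the solution starting at `p` at time `0`: the times `τ`
such that a solution with value `p` at time `0` exists on the closed interval between
`0` and `τ`. -/
def existenceInterval (α : ℝ) (p : ℝ × ℝ) : Set ℝ :=
  {τ | ∃ γ : ℝ → ℝ × ℝ, γ 0 = p ∧ IsIntegralCurveOn γ (fun _ => field α) (uIcc 0 τ)}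

open Classical in
/-- The maximal solution `τ ↦ (v(τ; p, α), z(τ; p, α))` with value `p` at time `0`. The field is
locally Lipschitz, so the value does not depend on the solution chosen. Outside the maximal
existence interval the value is a dummy, which is never used. -/
def sol (α : ℝ) (p : ℝ × ℝ) (τ : ℝ) : ℝ × ℝ :=
  if h : τ ∈ existenceInterval α p then Classical.choose h τ else p

/-- The component `dv/dτ` of the field at the point of the solution reached at time `τ`. -/
def speed (α : ℝ) (p : ℝ × ℝ) (τ : ℝ) : ℝ :=
  (sol α p τ).1 * f (sol α p τ).1 α + (sol α p τ).2 ^ 2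

/-- The time up to which `dv/dτ > 0` holds along the solution forward from `p`. -/
def tauBar (α : ℝ) (p : ℝ × ℝ) : EReal :=
  sSup ((fun τ : ℝ => (τ : EReal)) ''
    {τ | 0 < τ ∧ τ ∈ existenceInterval α p ∧ ∀ s ∈ Icc 0 τ, 0 < speed α p s})

/-- The time down to which `dv/dτ > 0` holds along the solution backward from `p`. -/
def tauUnder (α : ℝ) (p : ℝ × ℝ) : EReal :=
  sInf ((fun τ : ℝ => (τ : EReal)) ''
    {τ | τ < 0 ∧ τ ∈ existenceInterval α p ∧ ∀ s ∈ Icc τ 0, 0 < speed α p s})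

/-- `e` is the limit, in the extended reals, of `v(τ; p, α)` as the real time `τ` tends to
`tauBar α p` from below. -/
def IsForwardEnd (α : ℝ) (p : ℝ × ℝ) (e : EReal) : Prop :=
  Tendsto (fun τ : ℝ => (((sol α p τ).1 : ℝ) : EReal))
    (comap (fun τ : ℝ => (τ : EReal)) (𝓝[<] (tauBar α p))) (𝓝 e)

/-- `e` is the limit, in the extended reals, of `v(τ; p, α)` as the real time `τ` tends to
`tauUnder α p` from above. -/
def IsBackwardEnd (α : ℝ) (p : ℝ × ℝ) (e : EReal) : Prop :=
  Tendsto (fun τ : ℝ => (((sol α p τ).1 : ℝ) : EReal))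
    (comap (fun τ : ℝ => (τ : EReal)) (𝓝[>] (tauUnder α p))) (𝓝 e)

/-- The unstable separatrix `L⁻(α)` of the saddle `P₁(α)` in the open upper half plane: the points
whose solution exists for all negative times and tends to `P₁(α)` as `τ → -∞`. -/
def Lminus (α : ℝ) : Set (ℝ × ℝ) :=
  {p | 0 < p.2 ∧ Iic 0 ⊆ existenceInterval α p ∧ Tendsto (sol α p) atBot (𝓝 (P1 α))}

/-- The stable separatrix `L⁺(α)` of the saddle `P₃(α)` in the open upper half plane: the points
whose solution exists for all positive times and tends to `P₃(α)` as `τ → +∞`. -/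
def Lplus (α : ℝ) : Set (ℝ × ℝ) :=
  {p | 0 < p.2 ∧ Ici 0 ⊆ existenceInterval α p ∧ Tendsto (sol α p) atTop (𝓝 (P3 α))}

/-- `e` is the right endpoint `v⁻(α)` of `L⁻(α)`: points of `L⁻(α)` in `𝒟₂(α)` exist, and each of
them has forward end `e`. -/
def IsVMinus (α : ℝ) (e : EReal) : Prop :=
  (D2 α ∩ Lminus α).Nonempty ∧ ∀ p ∈ D2 α ∩ Lminus α, IsForwardEnd α p e

/-- `e` is the left endpoint `v⁺(α)` of `L⁺(α)`: points of `L⁺(α)` in `𝒟₃(α)` exist, and each of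
them has backward end `e`. -/
def IsVPlus (α : ℝ) (e : EReal) : Prop :=
  (D3 α ∩ Lplus α).Nonempty ∧ ∀ p ∈ D3 α ∩ Lplus α, IsBackwardEnd α p e

end PoincareSystem

end

/-!
In the upper half plane the quotient `u = v / z` satisfies `du/dτ = z`, so every orbit there is the
graph `z = Z(u)` of a positive solution of the scalar equation `dZ/du = f(u Z)`, with `v = u Z` and
`dv/dτ = z (Z + u f(u Z))`. Everything takes place where `v` lies between the outer zeros of `f`,
except for the final escape to infinity; hence `f` may be frozen to `0` outside this interval, and
the solutions of the scalar equation become global and never cross one another.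

As `u → ∞` there is exactly one solution with `u Z → v₃⁰`; its graph carries `L⁺`. It separates the
solutions for which `u Z` reaches `v₃⁰` from those for which it does not, and its initial value is
the infimum of the initial values of the former (`IsTruncated.tendsto_mul`). It is unique because
`f` increases near `v₃⁰`, so that the distance of two such solutions cannot tend to zero
(`IsTruncated.eq_of_tendsto`). The essential tool is a barrier: where `u Z` is positive and does not
increase, it stays below its value from then on (`IsSol.mul_lt_of_gain_nonpos`). As `u → -∞` there
is, by reflection, exactly one solution with `u Z → v₁⁰`; its graph carries `L⁻`.

The two graphs are therefore compared by their values at `u = 0`. Let `Z⁻` and `Z⁺` be the two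
solutions. If `Z⁻(0) ≤ 0`, then `L⁻` rises until it ends at the origin. If `0 < Z⁻(0) < Z⁺(0)`,
then `v` stops increasing along `L⁻` before `v₃⁰`. If `Z⁻(0) = Z⁺(0)`, then `L⁻` runs into the
saddle at `v₃⁰`. If `Z⁻(0) > Z⁺(0)`, then `L⁻` crosses `v = v₃⁰` and goes to infinity. This is
`exists_isRiseEnd`, proved for every cubic with zeros `r₁ < r₂ < r₃`, `r₁ < 0 < r₃` and `r₂ ≠ 0`.
Time reversal combined with `v ↦ -v` preserves this class and exchanges `L⁻` and `L⁺`, so the same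
statement describes the backward end of `L⁺`, with the order of `Z⁻(0)` and `Z⁺(0)` exchanged. As
`v₂⁰ < 0`, the reversed system has `r₂ > 0`, which gives `Z⁺(0) > 0` and excludes the origin as the
end of `L⁺`. The position of `Z⁻(0)` relative to `0` and `Z⁺(0)` is what distinguishes the four
cases.
-/

noncomputable section

namespace PoincareSystem

/-! ### Scalar differential equations with global solutions -/

/-- A time-dependent scalar field that is bounded, continuous in time, and Lipschitz in space
uniformly on bounded time intervals has a global solution through every point. -/
theorem exists_global_solution {F : ℝ → ℝ → ℝ} {M : ℝ} (hc : ∀ y, Continuous fun t => F t y)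
    (hM : ∀ t y, |F t y| ≤ M)
    (hL : ∀ T : ℝ, ∃ K : NNReal, ∀ t, |t| ≤ T → LipschitzWith K (F t)) (t₀ y₀ : ℝ) :
    ∃ y : ℝ → ℝ, y t₀ = y₀ ∧ ∀ t, HasDerivAt y (F t (y t)) t := by
  have hM0 : 0 ≤ M := (abs_nonneg _).trans (hM 0 0)
  have habs : ∀ (R t : ℝ), t ∈ Icc (t₀ - R) (t₀ + R) → |t| ≤ |t₀| + R := by
    intro R t ht
    have h1 : |t - t₀| ≤ R := abs_le.2 ⟨by linarith [ht.1], by linarith [ht.2]⟩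
    calc |t| = |t₀ + (t - t₀)| := by ring_nf
      _ ≤ |t₀| + |t - t₀| := abs_add_le _ _
      _ ≤ _ := by linarith
  have hloc : ∀ n : ℕ, ∃ y : ℝ → ℝ, y t₀ = y₀ ∧ ∀ t ∈ Icc (t₀ - (n + 1)) (t₀ + (n + 1)),
      HasDerivWithinAt y (F t (y t)) (Icc (t₀ - (n + 1)) (t₀ + (n + 1))) t := by
    intro n
    obtain ⟨K, hK⟩ := hL (|t₀| + (n + 1))
    have hn : (0 : ℝ) ≤ n := n.cast_nonneg
    have hmem : t₀ ∈ Icc (t₀ - ((n : ℝ) + 1)) (t₀ + (n + 1)) := ⟨by linarith, by linarith⟩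
    have hPL : IsPicardLindelof F (⟨t₀, hmem⟩ : Icc (t₀ - ((n : ℝ) + 1)) (t₀ + (n + 1))) y₀
        (⟨M * (n + 1), by positivity⟩) 0 ⟨M, hM0⟩ K :=
      { lipschitzOnWith := fun t ht => (hK t (habs _ t ht)).lipschitzOnWith
        continuousOn := fun y _ => (hc y).continuousOn
        norm_le := fun t _ y _ => hM t y
        mul_max_le := by
          have : max (t₀ + ((n : ℝ) + 1) - t₀) (t₀ - (t₀ - ((n : ℝ) + 1))) = n + 1 := by
            rw [max_eq_left] <;> linarith
          simp only [this, NNReal.coe_zero, sub_zero]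
          exact le_rfl }
    exact hPL.exists_eq_forall_mem_Icc_hasDerivWithinAt₀
  choose Y hY0 hY using hloc
  -- The local solutions agree where they are defined, and they are glued together.
  have hat : ∀ (n : ℕ) (t : ℝ), t ∈ Ioo (t₀ - ((n : ℝ) + 1)) (t₀ + (n + 1)) →
      HasDerivAt (Y n) (F t (Y n t)) t := fun n t ht =>
    (hY n t (Ioo_subset_Icc_self ht)).hasDerivAt (Icc_mem_nhds ht.1 ht.2)
  have hcons : ∀ (m n : ℕ), m ≤ n → ∀ t ∈ Ioo (t₀ - ((m : ℝ) + 1)) (t₀ + (m + 1)),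
      Y m t = Y n t := by
    intro m n hmn t ht
    have hmn' : (m : ℝ) ≤ n := by exact_mod_cast hmn
    have hm : (0 : ℝ) ≤ m := m.cast_nonneg
    obtain ⟨K, hK⟩ := hL (|t₀| + (m + 1))
    refine ODE_solution_unique_of_mem_Ioo (v := F) (s := fun _ => univ) (K := K)
      (fun s hs => (hK s (habs _ s (Ioo_subset_Icc_self hs))).lipschitzOnWith) (t₀ := t₀)
      ⟨by linarith, by linarith⟩ (fun s hs => ⟨hat m s hs, trivial⟩)
      (fun s hs => ⟨hat n s ⟨by linarith [hs.1], by linarith [hs.2]⟩, trivial⟩) ?_ ht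
    rw [hY0, hY0]
  refine ⟨fun t => Y ⌈|t - t₀|⌉₊ t, by simp [hY0], fun t => ?_⟩
  set N := ⌈|t - t₀|⌉₊ with hN
  have htN : |t - t₀| ≤ N := Nat.le_ceil _
  have hnear : (fun s => Y ⌈|s - t₀|⌉₊ s) =ᶠ[𝓝 t] Y (N + 1) := by
    have hev : ∀ᶠ s in 𝓝 t, |s - t₀| < N + 1 :=
      (by fun_prop : Continuous fun s : ℝ => |s - t₀|).continuousAt.eventually_lt
        continuousAt_const (by linarith)
    filter_upwards [hev] with s hs
    have h1 : ⌈|s - t₀|⌉₊ ≤ N + 1 := Nat.ceil_le.2 (by push_cast; exact hs.le)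
    refine hcons _ _ h1 s ?_
    have h2 := abs_le.1 (Nat.le_ceil |s - t₀|)
    constructor <;> linarith [h2.1, h2.2]
  have hd := hat (N + 1) t (by
    have h2 := abs_le.1 htN
    push_cast
    constructor <;> linarith [h2.1, h2.2])
  have := hd.congr_of_eventuallyEq hnear
  rwa [← hnear.eq_of_nhds] at this

/-- A function that is positive at `a` and increases through each of its zeros in `(a, b]` stays
positive. -/
theorem pos_of_deriv_pos_at_zeros {W W' : ℝ → ℝ} {a b : ℝ}
    (hW : ∀ x ∈ Icc a b, HasDerivWithinAt W (W' x) (Icc a b) x) (ha : 0 < W a)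
    (hz : ∀ x ∈ Ioc a b, W x = 0 → 0 < W' x) : ∀ x ∈ Icc a b, 0 < W x := by
  by_contra! hcon
  obtain ⟨x₁, hx₁, hWx₁⟩ := hcon
  have hcont : ContinuousOn W (Icc a b) := fun x hx => (hW x hx).continuousWithinAt
  have hcl : IsClosed (Icc a b ∩ W ⁻¹' Iic 0) := hcont.preimage_isClosed_of_isClosed
    isClosed_Icc isClosed_Iic
  obtain ⟨x, ⟨hx, hWx⟩, hmin⟩ :=
    (isCompact_Icc.of_isClosed_subset hcl inter_subset_left).exists_isLeast ⟨x₁, hx₁, hWx₁⟩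
  have hax : a < x := lt_of_le_of_ne hx.1 (by rintro rfl; exact absurd hWx (not_le.2 ha))
  have hbefore : ∀ y ∈ Ico a x, 0 < W y := by
    intro y hy
    by_contra! h
    exact absurd (hmin ⟨⟨hy.1, hy.2.le.trans hx.2⟩, h⟩) (not_le.2 hy.2)
  have hnhds : 𝓝[<] x ≤ 𝓝[Icc a b] x :=
    nhdsWithin_le_of_mem (mem_of_superset (Ico_mem_nhdsLT hax)
      fun y hy => ⟨hy.1, hy.2.le.trans hx.2⟩)
  have hlim : Tendsto W (𝓝[<] x) (𝓝 (W x)) :=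
    (hcont x hx).mono_left hnhds
  have hev : ∀ᶠ y in 𝓝[<] x, 0 < W y :=
    (Ico_mem_nhdsLT hax) |> fun h => Filter.mem_of_superset h hbefore
  have h0 : W x = 0 := le_antisymm hWx (ge_of_tendsto hlim (hev.mono fun _ h => h.le))
  have hs : Tendsto (slope W x) (𝓝[<] x) (𝓝 (W' x)) :=
    (hasDerivWithinAt_iff_tendsto_slope.1 (hW x hx)).mono_left <|
      nhdsWithin_le_of_mem <| mem_of_superset (Ico_mem_nhdsLT hax)
        fun y hy => ⟨⟨hy.1, hy.2.le.trans hx.2⟩, hy.2.ne⟩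
  have hle : W' x ≤ 0 := by
    refine le_of_tendsto hs ?_
    filter_upwards [hev, self_mem_nhdsWithin] with y hy hyx
    rw [slope_def_field, h0]
    exact div_nonpos_of_nonneg_of_nonpos (by linarith) (by linarith [mem_Iio.1 hyx])
  exact absurd (hz x ⟨hax, hx.2⟩ h0) (not_lt.2 hle)

/-- Variant of `pos_of_deriv_pos_at_zeros` that also admits a zero at the left endpoint. -/
theorem pos_of_deriv_pos_at_zeros' {W W' : ℝ → ℝ} {a b : ℝ}
    (hW : ∀ x ∈ Icc a b, HasDerivWithinAt W (W' x) (Icc a b) x) (ha : 0 ≤ W a)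
    (hz : ∀ x ∈ Icc a b, W x = 0 → 0 < W' x) : ∀ x ∈ Ioc a b, 0 < W x := by
  intro x hx
  rcases ha.lt_or_eq with h | h
  · exact pos_of_deriv_pos_at_zeros hW h (fun y hy => hz y ⟨hy.1.le, hy.2⟩) x ⟨hx.1.le, hx.2⟩
  have haI : a ∈ Icc a b := ⟨le_rfl, hx.1.le.trans hx.2⟩
  have hs : Tendsto (slope W a) (𝓝[>] a) (𝓝 (W' a)) :=
    (hasDerivWithinAt_iff_tendsto_slope.1 (hW a haI)).mono_left <|
      nhdsWithin_le_of_mem <| mem_of_superset (Ioc_mem_nhdsGT (hx.1.trans_le hx.2))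
        fun y hy => ⟨⟨hy.1.le, hy.2⟩, hy.1.ne'⟩
  have hev := hs.eventually (lt_mem_nhds (hz a haI h.symm))
  obtain ⟨y, hy, hya, hyx⟩ : ∃ y, 0 < slope W a y ∧ a < y ∧ y ≤ x := by
    obtain ⟨y, hy1, hy2⟩ := (hev.and (Ioc_mem_nhdsGT hx.1)).exists
    exact ⟨y, hy1, hy2.1, hy2.2⟩
  have hWy : 0 < W y := by
    rw [slope_def_field, ← h, sub_zero] at hy
    exact (div_pos_iff_of_pos_right (by linarith)).1 hy
  exact pos_of_deriv_pos_at_zeros (a := y) 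
    (fun t ht => (hW t ⟨hya.le.trans ht.1, ht.2⟩).mono (Icc_subset_Icc_left hya.le)) hWy
    (fun t ht => hz t ⟨(hya.trans ht.1).le, ht.2⟩) x ⟨hyx, hx.2⟩

/-- Global solutions `Y` of the scalar equation `dY/dx = h (x Y)`. For `h = f(·, α)` its positive
solutions are the orbits of the planar system in the upper half plane, with `x = v / z` and
`Y = z`. -/
def IsSol (h Y : ℝ → ℝ) : Prop := ∀ x, HasDerivAt Y (h (x * Y x)) x

/-- `Y + x h(x Y)`, the derivative of `x Y` along a solution of `dY/dx = h (x Y)`. -/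
def gain (h Y : ℝ → ℝ) (x : ℝ) : ℝ := Y x + x * h (x * Y x)

section

variable {h Y Y₁ Y₂ : ℝ → ℝ} {K : NNReal} {M : ℝ}

theorem IsSol.continuous (hY : IsSol h Y) : Continuous Y :=
  continuous_iff_continuousAt.2 fun x => (hY x).continuousAt

theorem IsSol.hasDerivAt_mul (hY : IsSol h Y) (x : ℝ) :
    HasDerivAt (fun x => x * Y x) (gain h Y x) x := by
  have := (hasDerivAt_id' x).fun_mul (hY x)
  rwa [one_mul] at this

theorem IsSol.continuous_mul (hY : IsSol h Y) : Continuous fun x => x * Y x :=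
  continuous_id.mul hY.continuous

theorem IsSol.continuous_gain (hY : IsSol h Y) (hh : Continuous h) : Continuous (gain h Y) :=
  hY.continuous.add (continuous_id.mul (hh.comp hY.continuous_mul))

theorem IsSol.reflect (hY : IsSol h Y) : IsSol (fun v => -h (-v)) fun x => Y (-x) := by
  intro x
  have := (hY (-x)).comp x (hasDerivAt_neg x)
  simpa [Function.comp_def] using this

theorem lipschitz_scaled (hh : LipschitzWith K h) {T t : ℝ} (ht : |t| ≤ T) :
    LipschitzWith (K * T.toNNReal) fun y => h (t * y) := by
  refine hh.comp (LipschitzWith.of_dist_le_mul fun y y' => ?_)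
  rw [Real.dist_eq, Real.dist_eq, ← mul_sub, abs_mul]
  exact mul_le_mul_of_nonneg_right (ht.trans (Real.le_coe_toNNReal T)) (abs_nonneg _)

theorem exists_isSol (hh : LipschitzWith K h) (hM : ∀ v, |h v| ≤ M) (x₀ y₀ : ℝ) :
    ∃ Y, IsSol h Y ∧ Y x₀ = y₀ := by
  obtain ⟨y, hy0, hy⟩ := exists_global_solution (F := fun t y => h (t * y)) (M := M)
    (fun y => hh.continuous.comp (by fun_prop)) (fun t y => hM _)
    (fun T => ⟨K * T.toNNReal, fun t ht => lipschitz_scaled hh ht⟩) x₀ y₀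
  exact ⟨y, hy, hy0⟩

theorem IsSol.unique (hh : LipschitzWith K h) (h₁ : IsSol h Y₁) (h₂ : IsSol h Y₂) {x₀ : ℝ}
    (h0 : Y₁ x₀ = Y₂ x₀) (x : ℝ) : Y₁ x = Y₂ x := by
  have hx : x ∈ Ioo (-(|x| + |x₀| + 1)) (|x| + |x₀| + 1) := by
    constructor <;> linarith [neg_abs_le x, le_abs_self x, abs_nonneg x₀]
  have hx₀ : x₀ ∈ Ioo (-(|x| + |x₀| + 1)) (|x| + |x₀| + 1) := by
    constructor <;> linarith [neg_abs_le x₀, le_abs_self x₀, abs_nonneg x]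
  exact ODE_solution_unique_of_mem_Ioo (v := fun t y => h (t * y)) (s := fun _ => univ)
    (K := K * (|x| + |x₀| + 1).toNNReal)
    (fun t ht => (lipschitz_scaled hh (abs_le.2 ⟨ht.1.le, ht.2.le⟩)).lipschitzOnWith) hx₀
    (fun t _ => ⟨h₁ t, trivial⟩) (fun t _ => ⟨h₂ t, trivial⟩) h0 hx

/-- Solutions of the scalar equation do not cross. -/
theorem IsSol.lt_of_lt (hh : LipschitzWith K h) (h₁ : IsSol h Y₁) (h₂ : IsSol h Y₂) {x₀ : ℝ}
    (h0 : Y₁ x₀ < Y₂ x₀) (x : ℝ) : Y₁ x < Y₂ x := by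
  by_contra! hcon
  obtain ⟨y, hy⟩ : (0 : ℝ) ∈ range fun x => Y₂ x - Y₁ x :=
    mem_range_of_exists_le_of_exists_ge (h₂.continuous.sub h₁.continuous)
      ⟨x, sub_nonpos.2 hcon⟩ ⟨x₀, (sub_pos.2 h0).le⟩
  have := h₁.unique hh h₂ (x₀ := y) (by simpa [sub_eq_zero, eq_comm] using hy) x₀
  linarith

end

/-! ### The separatrix of a truncated scalar equation on the half line -/

/-- The shape of a truncated nonlinearity near its largest zero `r`: bounded and Lipschitz,
negative on `(b, r)`, zero on `[r, ∞)` and nondecreasing on some `[m, ∞)` with `m < r`. -/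
structure IsTruncated (h : ℝ → ℝ) (b r : ℝ) : Prop where
  lip : ∃ K, LipschitzWith K h
  bdd : ∃ M : ℝ, ∀ v, |h v| ≤ M
  pos : 0 < r
  lt : b < r
  neg : ∀ v, b < v → v < r → h v < 0
  zero : ∀ v, r ≤ v → h v = 0
  mono : ∃ m < r, MonotoneOn h (Ici m)

/-- The initial values of the solutions `Y` for which `x Y` reaches `r` on the positive half
line. -/
def hitSet (h : ℝ → ℝ) (r : ℝ) : Set ℝ :=
  {c | ∃ Y, IsSol h Y ∧ Y 0 = c ∧ ∃ x > 0, r ≤ x * Y x}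

/-- The threshold between the solutions for which `x Y` reaches `r` and those for which it does
not. -/
def threshold (h : ℝ → ℝ) (r : ℝ) : ℝ := sInf (hitSet h r)

section

variable {h Y Y₁ Y₂ : ℝ → ℝ} {b r : ℝ}

/-- The product `x Y` cannot come back below a positive zero `c` of `h`. -/
theorem IsSol.lt_mul_of_le_mul (hY : IsSol h Y) {c x₀ : ℝ} (hc : 0 < c) (hx₀ : 0 < x₀)
    (hh : h c = 0) (h0 : c ≤ x₀ * Y x₀) {x : ℝ} (hx : x₀ < x) : c < x * Y x := by
  have := pos_of_deriv_pos_at_zeros' (W := fun x => x * Y x - c) (W' := gain h Y) (a := x₀)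
    (b := x) (fun t _ => ((hY.hasDerivAt_mul t).sub_const c).hasDerivWithinAt) (by simpa using h0)
    (fun t ht hWt => by
      have ht0 : 0 < t := hx₀.trans_le ht.1
      have hv : t * Y t = c := by linarith
      rw [gain, hv, hh, mul_zero, add_zero]
      exact (pos_iff_pos_of_mul_pos (hv ▸ hc)).1 ht0) x ⟨hx, le_rfl⟩
  linarith

/-- Where `x Y = v` would have nonpositive derivative at `x₀`, the constant `v` is a barrier from
above for `x Y` on `(x₀, ∞)`, because `v / x²` decreases. -/
theorem IsSol.mul_lt_of_mul_le (hT : IsTruncated h b r) (hY : IsSol h Y) {v x₀ : ℝ} (hv : 0 < v)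
    (hx₀ : 0 < x₀) (hc : v / x₀ ^ 2 + h v ≤ 0) (h0 : x₀ * Y x₀ ≤ v) {x : ℝ} (hx : x₀ < x) :
    x * Y x < v := by
  obtain ⟨K, hK⟩ := hT.lip
  obtain ⟨M, hM⟩ := hT.bdd
  have hgain : ∀ Z t, x₀ < t → t * Z t = v → gain h Z t < 0 := by
    intro Z t ht hZ
    have ht0 : 0 < t := hx₀.trans ht
    have h1 : v / t ^ 2 < v / x₀ ^ 2 := by gcongr
    have h2 : Z t = t * (v / t ^ 2) := by rw [← hZ]; field_simp
    have h3 : gain h Z t = t * (v / t ^ 2 + h v) := by rw [gain, hZ, mul_add, ← h2]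
    rw [h3]
    exact mul_neg_of_pos_of_neg ht0 (by linarith)
  have hstrict : ∀ Z, IsSol h Z → x₀ * Z x₀ < v → ∀ t, x₀ < t → t * Z t < v := by
    intro Z hZ hZ0 t ht
    have := pos_of_deriv_pos_at_zeros (W := fun x => v - x * Z x) (W' := fun x => -gain h Z x)
      (a := x₀) (b := t) (fun s _ => ((hZ.hasDerivAt_mul s).const_sub v).hasDerivWithinAt)
      (by simpa using hZ0)
      (fun s hs hWs => by linarith [hgain Z s hs.1 (by linarith)]) t ⟨ht.le, le_rfl⟩
    linarith
  -- Solutions starting below the barrier give the weak inequality, by order preservation.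
  have hweak : ∀ t, x₀ < t → t * Y t ≤ v := by
    intro t ht
    by_contra! hcon
    have ht0 : 0 < t := hx₀.trans ht
    obtain ⟨Z, hZ, hZt⟩ := exists_isSol hK hM t (v / t)
    have h1 : Z t < Y t := by rw [hZt, div_lt_iff₀ ht0]; linarith
    have h2 := hZ.lt_of_lt hK hY h1 x₀
    have h3 := hstrict Z hZ ((mul_lt_mul_of_pos_left h2 hx₀).trans_le h0) t ht
    rw [hZt, mul_div_cancel₀ _ ht0.ne'] at h3
    exact lt_irrefl _ h3
  refine (hweak x hx).lt_of_ne fun heq => ?_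
  have hs : Tendsto (slope (fun x => x * Y x) x) (𝓝[<] x) (𝓝 (gain h Y x)) :=
    (hasDerivAt_iff_tendsto_slope.1 (hY.hasDerivAt_mul x)).mono_left
      (nhdsWithin_mono _ fun y hy => ne_of_lt hy)
  refine absurd (hgain Y x hx heq) (not_lt.2 (ge_of_tendsto hs ?_))
  filter_upwards [Ioo_mem_nhdsLT hx] with y hy
  rw [slope_def_field, heq]
  exact div_nonneg_of_nonpos (by linarith [hweak y hy.1]) (by linarith [hy.2])

theorem IsTruncated.mul_lt_of_mul_le (hT : IsTruncated h b r) (hY : IsSol h Y) {x₀ x : ℝ}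
    (hx₀ : 0 < x₀) (hx : x₀ < x) (h0 : x * Y x ≤ r) : x₀ * Y x₀ < r := by
  by_contra! hcon
  have := hY.lt_mul_of_le_mul hT.pos hx₀ (hT.zero r le_rfl) hcon hx
  linarith

/-- Solutions that are below a barrier never reach `r`: not after it, and not before, since they
could not come back. -/
theorem IsTruncated.not_mem_hitSet (hT : IsTruncated h b r) (hY : IsSol h Y) {v x₀ : ℝ}
    (hv : 0 < v) (hvr : v < r) (hx₀ : 0 < x₀) (hc : v / x₀ ^ 2 + h v ≤ 0)
    (h0 : x₀ * Y x₀ ≤ v) : Y 0 ∉ hitSet h r := by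
  rintro ⟨Z, hZ, hZ0, x, hx, hZx⟩
  obtain ⟨K, hK⟩ := hT.lip
  rw [hZ.unique hK hY hZ0 x] at hZx
  rcases lt_trichotomy x x₀ with hxx | rfl | hxx
  · have := hT.mul_lt_of_mul_le hY hx hxx (by linarith)
    linarith
  · linarith
  · have := hY.mul_lt_of_mul_le hT hv hx₀ hc h0 hxx
    linarith

theorem IsTruncated.mem_hitSet_of_lt (hT : IsTruncated h b r) (hY : IsSol h Y) {c : ℝ}
    (hc : c ∈ hitSet h r) (hcY : c < Y 0) : Y 0 ∈ hitSet h r := by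
  obtain ⟨Z, hZ, rfl, x, hx, hZx⟩ := hc
  obtain ⟨K, hK⟩ := hT.lip
  exact ⟨Y, hY, rfl, x, hx,
    hZx.trans (mul_le_mul_of_nonneg_left (hZ.lt_of_lt hK hY hcY x).le hx.le)⟩

theorem IsTruncated.hitSet_nonempty (hT : IsTruncated h b r) : (hitSet h r).Nonempty := by
  obtain ⟨K, hK⟩ := hT.lip
  obtain ⟨M, hM⟩ := hT.bdd
  obtain ⟨Y, hY, hY1⟩ := exists_isSol hK hM 1 r
  exact ⟨Y 0, Y, hY, rfl, 1, one_pos, by rw [hY1, one_mul]⟩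

/-- Levels `v` at which `h` is negative become barriers from above for large `x`. -/
theorem exists_forall_barrier {v : ℝ} (hv : h v < 0) :
    ∃ X > 0, ∀ x ≥ X, v / x ^ 2 + h v ≤ 0 := by
  have : Tendsto (fun x : ℝ => v / x ^ 2 + h v) atTop (𝓝 (0 + h v)) :=
    (tendsto_const_nhds.div_atTop (tendsto_pow_atTop two_ne_zero)).add_const _
  obtain ⟨X, hX⟩ := (this.eventually (gt_mem_nhds (by rwa [zero_add]))).exists_forall_of_atTop
  exact ⟨max X 1, by positivity, fun x hx => (hX x ((le_max_left _ _).trans hx)).le⟩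

theorem IsTruncated.hitSet_bddBelow (hT : IsTruncated h b r) : BddBelow (hitSet h r) := by
  obtain ⟨K, hK⟩ := hT.lip
  obtain ⟨M, hM⟩ := hT.bdd
  obtain ⟨v, hbv, hvr⟩ := exists_between (max_lt hT.lt hT.pos)
  obtain ⟨X, hX, hbar⟩ := exists_forall_barrier (hT.neg v ((le_max_left _ _).trans_lt hbv) hvr)
  obtain ⟨Y, hY, hYX⟩ := exists_isSol hK hM X (v / X)
  refine ⟨Y 0, fun c hc => ?_⟩
  by_contra! hlt
  exact hT.not_mem_hitSet hY ((le_max_right _ _).trans_lt hbv) hvr hX (hbar X le_rfl)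
    (by rw [hYX, mul_div_cancel₀ _ hX.ne']) (hT.mem_hitSet_of_lt hY hc hlt)

/-- Above the threshold, `x Y` reaches `r`. -/
theorem IsTruncated.exists_le_mul_of_threshold_lt (hT : IsTruncated h b r) (hY : IsSol h Y)
    (h0 : threshold h r < Y 0) : ∃ x > 0, r ≤ x * Y x := by
  obtain ⟨c, hc, hcY⟩ := exists_lt_of_csInf_lt hT.hitSet_nonempty h0
  obtain ⟨Z, hZ, hZ0, x, hx, hZx⟩ := hT.mem_hitSet_of_lt hY hc hcY
  obtain ⟨K, hK⟩ := hT.lip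
  exact ⟨x, hx, by rwa [hZ.unique hK hY hZ0 x] at hZx⟩

/-- At or below the threshold, `x Y` stays below `r`. -/
theorem IsTruncated.mul_lt_of_le_threshold (hT : IsTruncated h b r) (hY : IsSol h Y)
    (h0 : Y 0 ≤ threshold h r) {x : ℝ} (hx : 0 < x) : x * Y x < r := by
  by_contra! hcon
  obtain ⟨K, hK⟩ := hT.lip
  obtain ⟨M, hM⟩ := hT.bdd
  -- A slightly lower solution still reaches `r`, a little later.
  have hx1 : 0 < x + 1 := by linarith
  have h1 := hY.lt_mul_of_le_mul hT.pos hx (hT.zero r le_rfl) hcon (lt_add_one x)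
  obtain ⟨Z, hZ, hZx⟩ := exists_isSol hK hM (x + 1) (r / (x + 1))
  have h2 : Z 0 < Y 0 := hZ.lt_of_lt hK hY (x₀ := x + 1)
    (by rw [hZx, div_lt_iff₀ hx1]; linarith) 0
  have h3 : Z 0 ∈ hitSet h r :=
    ⟨Z, hZ, rfl, x + 1, hx1, by rw [hZx, mul_div_cancel₀ _ hx1.ne']⟩
  have := csInf_le hT.hitSet_bddBelow h3
  rw [threshold] at h0
  linarith

/-- A solution starting at the threshold stays above every barrier, as solutions below a barrier
start strictly below the threshold. -/
theorem IsTruncated.le_mul_of_barrier (hT : IsTruncated h b r) (hY : IsSol h Y)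
    (h0 : Y 0 = threshold h r) {v x : ℝ} (hv : 0 < v) (hvr : v < r) (hx : 0 < x)
    (hc : v / x ^ 2 + h v ≤ 0) : v ≤ x * Y x := by
  by_contra! hcon
  obtain ⟨K, hK⟩ := hT.lip
  obtain ⟨M, hM⟩ := hT.bdd
  obtain ⟨Z, hZ, hZx⟩ := exists_isSol hK hM x (v / x)
  have h2 : Y 0 < Z 0 := hY.lt_of_lt hK hZ (x₀ := x)
    (by rw [hZx, lt_div_iff₀ hx]; linarith) 0
  obtain ⟨t, ht, hZt⟩ := hT.exists_le_mul_of_threshold_lt hZ (h0 ▸ h2)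
  exact hT.not_mem_hitSet hZ hv hvr hx hc (by rw [hZx, mul_div_cancel₀ _ hx.ne'])
    ⟨Z, hZ, rfl, t, ht, hZt⟩

/-- For a solution starting at the threshold, `x Y` tends to `r`. -/
theorem IsTruncated.tendsto_mul (hT : IsTruncated h b r) (hY : IsSol h Y)
    (h0 : Y 0 = threshold h r) : Tendsto (fun x => x * Y x) atTop (𝓝 r) := by
  rw [tendsto_order]
  refine ⟨fun a ha => ?_, fun a ha => ?_⟩
  · obtain ⟨v, hbv, hvr⟩ := exists_between (max_lt (max_lt hT.lt hT.pos) ha)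
    have hv := max_lt_iff.1 hbv
    have hv' := max_lt_iff.1 hv.1
    obtain ⟨X, hX, hbar⟩ := exists_forall_barrier (hT.neg v hv'.1 hvr)
    filter_upwards [eventually_ge_atTop X] with x hx
    exact hv.2.trans_le (hT.le_mul_of_barrier hY h0 hv'.2 hvr (hX.trans_le hx) (hbar x hx))
  · filter_upwards [eventually_gt_atTop 0] with x hx
    exact (hT.mul_lt_of_le_threshold hY h0.le hx).trans ha

theorem barrier_of_gain_nonpos {x : ℝ} (hx : 0 < x) (hg : gain h Y x ≤ 0) :
    x * Y x / x ^ 2 + h (x * Y x) ≤ 0 := by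
  have : gain h Y x = x * (x * Y x / x ^ 2 + h (x * Y x)) := by rw [gain]; field_simp
  rw [this] at hg
  exact nonpos_of_mul_nonpos_right hg hx

/-- Once `x Y` is positive and does not increase, it stays below its value. -/
theorem IsSol.mul_lt_of_gain_nonpos (hT : IsTruncated h b r) (hY : IsSol h Y) {x₀ x : ℝ}
    (hx₀ : 0 < x₀) (hv : 0 < x₀ * Y x₀) (hg : gain h Y x₀ ≤ 0) (hx : x₀ < x) :
    x * Y x < x₀ * Y x₀ :=
  hY.mul_lt_of_mul_le hT hv hx₀ (barrier_of_gain_nonpos hx₀ hg) le_rfl hx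

/-- For a solution starting at the threshold, `x Y` increases wherever it is positive. -/
theorem IsTruncated.gain_pos (hT : IsTruncated h b r) (hY : IsSol h Y)
    (h0 : Y 0 = threshold h r) {x : ℝ} (hx : 0 < x) (hv : 0 < x * Y x) : 0 < gain h Y x := by
  by_contra! hg
  have h1 := hY.mul_lt_of_gain_nonpos hT hx hv hg (lt_add_one x)
  have h2 := barrier_of_gain_nonpos hx hg
  have h3 : x * Y x / (x + 1) ^ 2 ≤ x * Y x / x ^ 2 := by gcongr; linarith
  have := hT.le_mul_of_barrier hY h0 hv (hT.mul_lt_of_le_threshold hY h0.le hx)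
    (x := x + 1) (by linarith) (by linarith)
  linarith

theorem IsTruncated.not_lt_of_tendsto (hT : IsTruncated h b r) (h₁ : IsSol h Y₁)
    (h₂ : IsSol h Y₂) (ht₁ : Tendsto (fun x => x * Y₁ x) atTop (𝓝 r))
    (ht₂ : Tendsto (fun x => x * Y₂ x) atTop (𝓝 r)) : ¬ Y₁ 0 < Y₂ 0 := by
  intro hlt
  obtain ⟨K, hK⟩ := hT.lip
  obtain ⟨m, hm, hmono⟩ := hT.mono
  have hpos : ∀ x, 0 < Y₂ x - Y₁ x := fun x => sub_pos.2 (h₁.lt_of_lt hK h₂ hlt x)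
  obtain ⟨X, hX⟩ := ((eventually_gt_atTop 0).and ((ht₁.eventually (lt_mem_nhds hm)).and
    (ht₂.eventually (lt_mem_nhds hm)))).exists_forall_of_atTop
  have hd : ∀ x, HasDerivAt (fun x => Y₂ x - Y₁ x) (h (x * Y₂ x) - h (x * Y₁ x)) x :=
    fun x => (h₂ x).sub (h₁ x)
  have hmon : MonotoneOn (fun x => Y₂ x - Y₁ x) (Ici X) := by
    refine monotoneOn_of_deriv_nonneg (convex_Ici X)
      (fun x _ => (hd x).continuousAt.continuousWithinAt)
      (fun x _ => (hd x).differentiableAt.differentiableWithinAt) fun x hx => ?_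
    rw [interior_Ici] at hx
    obtain ⟨hx0, hx1, hx2⟩ := hX x (le_of_lt hx)
    rw [(hd x).deriv, sub_nonneg]
    exact hmono (le_of_lt hx1) (le_of_lt hx2)
      (mul_le_mul_of_nonneg_left (sub_pos.1 (hpos x)).le hx0.le)
  have hlim : Tendsto (fun x => Y₂ x - Y₁ x) atTop (𝓝 0) := by
    refine ((ht₂.sub ht₁).div_atTop tendsto_id).congr' ?_
    filter_upwards [eventually_gt_atTop 0] with x hx
    simp only [id]
    field_simp
  have : Y₂ X - Y₁ X ≤ 0 := ge_of_tendsto hlim <| by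
    filter_upwards [eventually_ge_atTop X] with x hx
    exact hmon self_mem_Ici hx hx
  linarith [hpos X]

/-- Two solutions with `x Y → r` coincide: their distance is eventually nondecreasing, and it
tends to zero. -/
theorem IsTruncated.eq_of_tendsto (hT : IsTruncated h b r) (h₁ : IsSol h Y₁)
    (h₂ : IsSol h Y₂) (ht₁ : Tendsto (fun x => x * Y₁ x) atTop (𝓝 r))
    (ht₂ : Tendsto (fun x => x * Y₂ x) atTop (𝓝 r)) (x : ℝ) : Y₁ x = Y₂ x := by
  obtain ⟨K, hK⟩ := hT.lip
  exact h₁.unique hK h₂ (le_antisymm (not_lt.1 (hT.not_lt_of_tendsto h₂ h₁ ht₂ ht₁))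
    (not_lt.1 (hT.not_lt_of_tendsto h₁ h₂ ht₁ ht₂))) x

/-- Below the threshold, `x Y` does not increase forever once it has passed `b`. -/
theorem IsTruncated.exists_gain_nonpos (hT : IsTruncated h b r) (hY : IsSol h Y)
    (h0 : Y 0 < threshold h r) {x₀ : ℝ} (hx₀ : 0 < x₀) (hb : b < x₀ * Y x₀) :
    ∃ x ≥ x₀, gain h Y x ≤ 0 := by
  by_contra! hcon
  obtain ⟨K, hK⟩ := hT.lip
  obtain ⟨M, hM⟩ := hT.bdd
  have hlt : ∀ x ≥ x₀, x * Y x < r := fun x hx =>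
    hT.mul_lt_of_le_threshold hY h0.le (hx₀.trans_le hx)
  have hmon : MonotoneOn (fun x => x * Y x) (Ici x₀) := by
    refine monotoneOn_of_deriv_nonneg (convex_Ici x₀) hY.continuous_mul.continuousOn
      (fun x _ => (hY.hasDerivAt_mul x).differentiableAt.differentiableWithinAt) fun x hx => ?_
    rw [interior_Ici] at hx
    rw [(hY.hasDerivAt_mul x).deriv]
    exact (hcon x (le_of_lt hx)).le
  obtain ⟨v, hv, hbound⟩ : ∃ v < r, ∀ x ≥ x₀, x * Y x ≤ v := by
    by_contra! hno
    have ht : Tendsto (fun x => x * Y x) atTop (𝓝 r) := by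
      rw [tendsto_order]
      refine ⟨fun a ha => ?_, fun a ha => ?_⟩
      · obtain ⟨x, hx, hax⟩ := hno a ha
        filter_upwards [eventually_ge_atTop x] with y hy
        exact hax.trans_le (hmon hx (hx.trans hy) hy)
      · filter_upwards [eventually_ge_atTop x₀] with x hx
        exact (hlt x hx).trans ha
    obtain ⟨Z, hZ, hZ0⟩ := exists_isSol hK hM 0 (threshold h r)
    have := hT.eq_of_tendsto hY hZ ht (hT.tendsto_mul hZ hZ0) 0
    rw [hZ0] at this
    exact absurd this h0.ne
  have hne : (Icc (x₀ * Y x₀) v).Nonempty := nonempty_Icc.2 (hbound x₀ le_rfl)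
  obtain ⟨w, hw, hmax⟩ := isCompact_Icc.exists_isMaxOn hne hK.continuous.continuousOn
  have hwneg : h w < 0 := hT.neg w (hb.trans_le hw.1) (hw.2.trans_lt hv)
  have hlim : Tendsto (fun x : ℝ => r / x ^ 2 + h w) atTop (𝓝 (0 + h w)) :=
    (tendsto_const_nhds.div_atTop (tendsto_pow_atTop two_ne_zero)).add_const _
  obtain ⟨x, hneg, hx⟩ := ((hlim.eventually (gt_mem_nhds (by rwa [zero_add]))).and
    (eventually_ge_atTop x₀)).exists
  have hx0 : 0 < x := hx₀.trans_le hx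
  have h1 : h (x * Y x) ≤ h w := hmax ⟨hmon self_mem_Ici hx hx, hbound x hx⟩
  have h2 : x * Y x / x ^ 2 ≤ r / x ^ 2 := by
    gcongr
    exact (hlt x hx).le
  have h3 : gain h Y x = x * (x * Y x / x ^ 2 + h (x * Y x)) := by rw [gain]; field_simp
  have := hcon x hx
  rw [h3] at this
  linarith [(pos_iff_pos_of_mul_pos this).1 hx0]

end

/-! ### Truncated cubics and their separatrices -/

/-- The cubic with zeros `r₁`, `r₂`, `r₃`. -/
def cubic (r₁ r₂ r₃ v : ℝ) : ℝ := (v - r₁) * (v - r₂) * (v - r₃)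

/-- The configurations of zeros to which the analysis applies. They are exchanged by the
reflection `(r₁, r₂, r₃) ↦ (-r₃, -r₂, -r₁)`, which corresponds to time reversal. -/
structure IsRootTriple (r₁ r₂ r₃ : ℝ) : Prop where
  lt₁₂ : r₁ < r₂
  lt₂₃ : r₂ < r₃
  neg : r₁ < 0
  pos : 0 < r₃
  ne : r₂ ≠ 0

/-- The function `k` frozen to the left of `c` and to the right of `d`. -/
def clamp (k : ℝ → ℝ) (c d v : ℝ) : ℝ := k (max c (min d v))

/-- The cubic frozen to the value `0` outside `[r₁, r₃]`. -/
def clampedCubic (r₁ r₂ r₃ : ℝ) : ℝ → ℝ := clamp (cubic r₁ r₂ r₃) r₁ r₃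

/-- The initial value at `x = 0` of the solution with `x Y → r₃` as `x → ∞`. The initial value of
the solution with `x Y → r₁` as `x → -∞` is obtained for the reflected zeros
`-r₃`, `-r₂`, `-r₁`. -/
def cubicThreshold (r₁ r₂ r₃ : ℝ) : ℝ := threshold (clampedCubic r₁ r₂ r₃) r₃

section

variable {r₁ r₂ r₃ : ℝ}

theorem IsRootTriple.reflect (hr : IsRootTriple r₁ r₂ r₃) : IsRootTriple (-r₃) (-r₂) (-r₁) :=
  ⟨neg_lt_neg hr.lt₂₃, neg_lt_neg hr.lt₁₂, neg_lt_zero.2 hr.pos, neg_pos.2 hr.neg,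
    neg_ne_zero.2 hr.ne⟩

theorem IsRootTriple.lt₁₃ (hr : IsRootTriple r₁ r₂ r₃) : r₁ < r₃ := hr.lt₁₂.trans hr.lt₂₃

theorem contDiff_cubic : ContDiff ℝ 1 (cubic r₁ r₂ r₃) := by
  unfold cubic
  fun_prop

theorem cubic_neg (v : ℝ) : cubic (-r₃) (-r₂) (-r₁) v = -cubic r₁ r₂ r₃ (-v) := by
  unfold cubic
  ring

theorem cubic_pos_of_mem (hr : IsRootTriple r₁ r₂ r₃) {v : ℝ} (h₁ : r₁ < v) (h₂ : v < r₂) :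
    0 < cubic r₁ r₂ r₃ v := by
  have := hr.lt₂₃
  exact mul_pos_of_neg_of_neg (mul_neg_of_pos_of_neg (by linarith) (by linarith)) (by linarith)

theorem cubic_neg_of_mem (hr : IsRootTriple r₁ r₂ r₃) {v : ℝ} (h₁ : r₂ < v) (h₂ : v < r₃) :
    cubic r₁ r₂ r₃ v < 0 := by
  have := hr.lt₁₂
  exact mul_neg_of_pos_of_neg (mul_pos (by linarith) (by linarith)) (by linarith)

theorem cubic_nonneg_of_le (hr : IsRootTriple r₁ r₂ r₃) {v : ℝ} (h₁ : r₃ ≤ v) :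
    0 ≤ cubic r₁ r₂ r₃ v := by
  have := hr.lt₁₂
  have := hr.lt₂₃
  exact mul_nonneg (mul_nonneg (by linarith) (by linarith)) (by linarith)

theorem cubic_nonpos_of_le (hr : IsRootTriple r₁ r₂ r₃) {v : ℝ} (h₁ : v ≤ r₁) :
    cubic r₁ r₂ r₃ v ≤ 0 := by
  have := hr.lt₁₂
  have := hr.lt₂₃
  exact mul_nonpos_of_nonneg_of_nonpos
    (mul_nonneg_of_nonpos_of_nonpos (by linarith) (by linarith)) (by linarith)

theorem clamp_of_mem {k : ℝ → ℝ} {c d v : ℝ} (hv : v ∈ Icc c d) : clamp k c d v = k v := by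
  rw [clamp, min_eq_right hv.2, max_eq_right hv.1]

theorem exists_lipschitzWith_clamp {k : ℝ → ℝ} (hk : ContDiff ℝ 1 k) {c d : ℝ} (hcd : c ≤ d) :
    ∃ K, LipschitzWith K (clamp k c d) := by
  obtain ⟨K, hK⟩ := hk.contDiffOn.exists_lipschitzOnWith one_ne_zero (convex_Icc c d)
    isCompact_Icc
  refine ⟨K, fun v w => (hK ⟨le_max_left _ _, max_le hcd (min_le_left _ _)⟩
    ⟨le_max_left _ _, max_le hcd (min_le_left _ _)⟩).trans ?_⟩
  have : LipschitzWith 1 fun v : ℝ => max c (min d v) :=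
    (LipschitzWith.id.const_min d).const_max c
  simpa using mul_le_mul_right (this v w) (K : ENNReal)

theorem exists_bound_clamp {k : ℝ → ℝ} (hk : Continuous k) {c d : ℝ} (hcd : c ≤ d) :
    ∃ M : ℝ, ∀ v, |clamp k c d v| ≤ M := by
  obtain ⟨M, hM⟩ := isCompact_Icc.exists_bound_of_continuousOn (hk.continuousOn (s := Icc c d))
  exact ⟨M, fun v => hM _ ⟨le_max_left _ _, max_le hcd (min_le_left _ _)⟩⟩

theorem clampedCubic_neg (hr : IsRootTriple r₁ r₂ r₃) :
    clampedCubic (-r₃) (-r₂) (-r₁) = fun v => -clampedCubic r₁ r₂ r₃ (-v) := by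
  funext v
  rw [clampedCubic, clamp, cubic_neg, clampedCubic, clamp]
  congr 2
  have := hr.lt₁₃
  rcases le_total (-r₁) v with h | h <;> rcases le_total (-r₃) v with h' | h' <;>
    simp only [min_def, max_def] <;> split_ifs <;> linarith

theorem clampedCubic_of_mem {v : ℝ} (hv : v ∈ Icc r₁ r₃) :
    clampedCubic r₁ r₂ r₃ v = cubic r₁ r₂ r₃ v := clamp_of_mem hv

theorem clampedCubic_of_ge (hr : IsRootTriple r₁ r₂ r₃) {v : ℝ} (hv : r₃ ≤ v) :
    clampedCubic r₁ r₂ r₃ v = 0 := by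
  rw [clampedCubic, clamp, min_eq_left hv, max_eq_right hr.lt₁₃.le, cubic, sub_self, mul_zero]

/-- Near its largest zero, where its derivative is positive, the cubic is nondecreasing. -/
theorem exists_monotoneOn_clampedCubic (hr : IsRootTriple r₁ r₂ r₃) :
    ∃ m < r₃, MonotoneOn (clampedCubic r₁ r₂ r₃) (Ici m) := by
  have h₁ : 0 < r₃ - r₁ := sub_pos.2 hr.lt₁₃
  have h₂ : 0 < r₃ - r₂ := sub_pos.2 hr.lt₂₃
  -- This `δ` makes the linear terms of the difference quotient at `r₃` at most its constant term.
  set δ := (r₃ - r₁) * (r₃ - r₂) / (2 * ((r₃ - r₁) + (r₃ - r₂))) with hδ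
  have hδ0 : 0 < δ := by positivity
  have hδm : δ * (2 * ((r₃ - r₁) + (r₃ - r₂))) = (r₃ - r₁) * (r₃ - r₂) := by
    rw [hδ]; field_simp
  have hmono : ∀ s t, 0 ≤ s → s ≤ t → t ≤ δ →
      cubic r₁ r₂ r₃ (r₃ - t) ≤ cubic r₁ r₂ r₃ (r₃ - s) := by
    intro s t hs hst ht
    have h3 : cubic r₁ r₂ r₃ (r₃ - s) - cubic r₁ r₂ r₃ (r₃ - t) = (t - s) *
        ((r₃ - r₁) * (r₃ - r₂) - ((r₃ - r₁) + (r₃ - r₂)) * (t + s) + (t ^ 2 + t * s + s ^ 2)) := by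
      unfold cubic; ring
    have h4 : ((r₃ - r₁) + (r₃ - r₂)) * (t + s) ≤ (r₃ - r₁) * (r₃ - r₂) := by
      rw [← hδm]
      nlinarith
    have h5 : 0 ≤ t := hs.trans hst
    have : 0 ≤ cubic r₁ r₂ r₃ (r₃ - s) - cubic r₁ r₂ r₃ (r₃ - t) := by
      rw [h3]
      exact mul_nonneg (by linarith) (by nlinarith [mul_nonneg h5 hs])
    linarith
  refine ⟨max r₁ (r₃ - δ), max_lt hr.lt₁₃ (by linarith), fun v hv w hw hvw => ?_⟩
  have hv' := max_le_iff.1 (mem_Ici.1 hv)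
  have hval : ∀ v, r₁ ≤ v → clampedCubic r₁ r₂ r₃ v = cubic r₁ r₂ r₃ (r₃ - (r₃ - min r₃ v)) := by
    intro v hv
    rw [clampedCubic, clamp, max_eq_right (le_min hr.lt₁₃.le hv), sub_sub_cancel]
  rw [hval v hv'.1, hval w (hv'.1.trans hvw)]
  refine hmono _ _ (by linarith [min_le_left r₃ w]) (by linarith [min_le_min_left r₃ hvw]) ?_
  have : r₃ - δ ≤ min r₃ v := le_min (by linarith) hv'.2
  linarith

theorem isTruncated_clampedCubic (hr : IsRootTriple r₁ r₂ r₃) :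
    IsTruncated (clampedCubic r₁ r₂ r₃) r₂ r₃ where
  lip := exists_lipschitzWith_clamp contDiff_cubic hr.lt₁₃.le
  bdd := exists_bound_clamp contDiff_cubic.continuous hr.lt₁₃.le
  pos := hr.pos
  lt := hr.lt₂₃
  neg v h₁ h₂ := by
    rw [clampedCubic_of_mem ⟨(hr.lt₁₂.trans h₁).le, h₂.le⟩]
    exact cubic_neg_of_mem hr h₁ h₂
  zero _ := clampedCubic_of_ge hr
  mono := exists_monotoneOn_clampedCubic hr

theorem gain_reflect {h Y : ℝ → ℝ} (x : ℝ) :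
    gain (fun v => -h (-v)) (fun x => Y (-x)) x = gain h Y (-x) := by
  simp [gain]

/-- `Z` is the solution of the truncated scalar equation whose graph is the unstable separatrix of
`(r₁, 0)`: the unique solution with `u Z → r₁` as `u → -∞`. -/
structure IsLeftSeparatrix (r₁ r₂ r₃ : ℝ) (Z : ℝ → ℝ) : Prop where
  sol : IsSol (clampedCubic r₁ r₂ r₃) Z
  eq_threshold : Z 0 = cubicThreshold (-r₃) (-r₂) (-r₁)
  lt : ∀ u < 0, r₁ < u * Z u
  tendsto : Tendsto (fun u => u * Z u) atBot (𝓝 r₁)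
  gain_pos_of_neg : ∀ u < 0, 0 < Z u → 0 < gain (clampedCubic r₁ r₂ r₃) Z u
  unique : ∀ Z', IsSol (clampedCubic r₁ r₂ r₃) Z' →
    Tendsto (fun u => u * Z' u) atBot (𝓝 r₁) → ∀ u, Z' u = Z u

theorem exists_isLeftSeparatrix (hr : IsRootTriple r₁ r₂ r₃) :
    ∃ Z, IsLeftSeparatrix r₁ r₂ r₃ Z := by
  have hT := isTruncated_clampedCubic hr.reflect
  obtain ⟨K, hK⟩ := hT.lip
  obtain ⟨M, hM⟩ := hT.bdd
  obtain ⟨Y, hY, hY0⟩ := exists_isSol hK hM 0 (cubicThreshold (-r₃) (-r₂) (-r₁))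
  have hback : clampedCubic r₁ r₂ r₃ = fun v => -clampedCubic (-r₃) (-r₂) (-r₁) (-v) := by
    simp [clampedCubic_neg hr]
  have hlim : ∀ W : ℝ → ℝ, Tendsto (fun x => x * W x) atTop (𝓝 (-r₁)) →
      Tendsto (fun u => u * W (-u)) atBot (𝓝 r₁) := by
    intro W hW
    simpa [Function.comp_def] using (hW.comp tendsto_neg_atBot_atTop).neg
  refine ⟨fun u => Y (-u), ?_, by simpa using hY0, fun u hu => ?_, hlim Y (hT.tendsto_mul hY hY0),
    fun u hu hZ => ?_, fun Z' hZ' ht u => ?_⟩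
  · rw [hback]
    exact hY.reflect
  · have := hT.mul_lt_of_le_threshold hY hY0.le (neg_pos.2 hu)
    linarith
  · rw [hback, gain_reflect]
    exact hT.gain_pos hY hY0 (neg_pos.2 hu) (mul_pos (neg_pos.2 hu) hZ)
  · have h1 := hZ'.reflect
    rw [← clampedCubic_neg hr] at h1
    have h2 : Tendsto (fun x => x * Z' (-x)) atTop (𝓝 (-r₁)) := by
      simpa [Function.comp_def] using (ht.comp tendsto_neg_atTop_atBot).neg
    have := hT.eq_of_tendsto h1 hY h2 (hT.tendsto_mul hY hY0) (-u)
    simpa using this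

end

/-! ### Orbits of the planar system as graphs over `v / z` -/

/-- The planar field `(v, z) ↦ (v k(v) + z², z k(v))`. -/
def planarField (k : ℝ → ℝ) (p : ℝ × ℝ) : ℝ × ℝ := (p.1 * k p.1 + p.2 ^ 2, p.2 * k p.1)

/-- Uniqueness for an initial time anywhere in a closed interval, endpoints included. -/
theorem eqOn_Icc_of_hasDerivWithinAt {E : Type*} [NormedAddCommGroup E] [NormedSpace ℝ E]
    {F : ℝ → E → E} {s : Set E} {K : NNReal} {a b c : ℝ} {γ η : ℝ → E}
    (hF : ∀ t ∈ Icc a b, LipschitzOnWith K (F t) s)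
    (hγ : ∀ t ∈ Icc a b, HasDerivWithinAt γ (F t (γ t)) (Icc a b) t)
    (hγs : ∀ t ∈ Icc a b, γ t ∈ s)
    (hη : ∀ t ∈ Icc a b, HasDerivWithinAt η (F t (η t)) (Icc a b) t)
    (hηs : ∀ t ∈ Icc a b, η t ∈ s) (hc : c ∈ Icc a b) (h : γ c = η c) :
    EqOn γ η (Icc a b) := by
  have hleft : Icc a c ⊆ Icc a b := Icc_subset_Icc_right hc.2
  have hright : Icc c b ⊆ Icc a b := Icc_subset_Icc_left hc.1
  have hcγ : ContinuousOn γ (Icc a b) := fun t ht => (hγ t ht).continuousWithinAt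
  have hcη : ContinuousOn η (Icc a b) := fun t ht => (hη t ht).continuousWithinAt
  rw [← Icc_union_Icc_eq_Icc hc.1 hc.2]
  refine EqOn.union ?_ ?_
  · have hsub : ∀ t ∈ Ioc a c, t ∈ Icc a b := fun t ht => hleft (Ioc_subset_Icc_self ht)
    have hn : ∀ t ∈ Ioc a c, Icc a b ∈ 𝓝[≤] t := fun t ht =>
      mem_of_superset (Icc_mem_nhdsLE ht.1) (Icc_subset_Icc_right (ht.2.trans hc.2))
    exact ODE_solution_unique_of_mem_Icc_left (v := F) (s := fun _ => s)
      (fun t ht => hF t (hsub t ht)) (hcγ.mono hleft)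
      (fun t ht => (hγ t (hsub t ht)).mono_of_mem_nhdsWithin (hn t ht))
      (fun t ht => hγs t (hsub t ht)) (hcη.mono hleft)
      (fun t ht => (hη t (hsub t ht)).mono_of_mem_nhdsWithin (hn t ht))
      (fun t ht => hηs t (hsub t ht)) h
  · have hsub : ∀ t ∈ Ico c b, t ∈ Icc a b := fun t ht => hright (Ico_subset_Icc_self ht)
    have hn : ∀ t ∈ Ico c b, Icc a b ∈ 𝓝[≥] t := fun t ht =>
      mem_of_superset (Icc_mem_nhdsGE ht.2) (Icc_subset_Icc_left (hc.1.trans ht.1))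
    exact ODE_solution_unique_of_mem_Icc_right (v := F) (s := fun _ => s)
      (fun t ht => hF t (hsub t ht)) (hcγ.mono hright)
      (fun t ht => (hγ t (hsub t ht)).mono_of_mem_nhdsWithin (hn t ht))
      (fun t ht => hγs t (hsub t ht)) (hcη.mono hright)
      (fun t ht => (hη t (hsub t ht)).mono_of_mem_nhdsWithin (hn t ht))
      (fun t ht => hηs t (hsub t ht)) h

section

variable {k : ℝ → ℝ} {γ η : ℝ → ℝ × ℝ} {a b c : ℝ}

theorem contDiff_planarField (hk : ContDiff ℝ 1 k) : ContDiff ℝ 1 (planarField k) := by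
  unfold planarField
  fun_prop

theorem eqOn_of_isIntegralCurveOn (hk : ContDiff ℝ 1 k)
    (hγ : IsIntegralCurveOn γ (fun _ => planarField k) (Icc a b))
    (hη : IsIntegralCurveOn η (fun _ => planarField k) (Icc a b)) (hc : c ∈ Icc a b)
    (h : γ c = η c) : EqOn γ η (Icc a b) := by
  obtain ⟨R, hR⟩ := isCompact_Icc.exists_bound_of_continuousOn hγ.continuousOn
  obtain ⟨R', hR'⟩ := isCompact_Icc.exists_bound_of_continuousOn hη.continuousOn
  obtain ⟨K, hK⟩ := (contDiff_planarField hk).contDiffOn.exists_lipschitzOnWith one_ne_zero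
    (convex_closedBall (0 : ℝ × ℝ) (max R R')) (isCompact_closedBall _ _)
  exact eqOn_Icc_of_hasDerivWithinAt (fun _ _ => hK) hγ
    (fun t ht => by simpa using Or.inl (hR t ht)) hη
    (fun t ht => by simpa using Or.inr (hR' t ht)) hc h

theorem hasDerivWithinAt_fst {s : Set ℝ} (hγ : IsIntegralCurveOn γ (fun _ => planarField k) s)
    {t : ℝ} (ht : t ∈ s) :
    HasDerivWithinAt (fun t => (γ t).1) ((γ t).1 * k (γ t).1 + (γ t).2 ^ 2) s t := by
  exact hasFDerivAt_fst.comp_hasDerivWithinAt t (hγ t ht)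

theorem hasDerivWithinAt_snd {s : Set ℝ} (hγ : IsIntegralCurveOn γ (fun _ => planarField k) s)
    {t : ℝ} (ht : t ∈ s) :
    HasDerivWithinAt (fun t => (γ t).2) ((γ t).2 * k (γ t).1) s t := by
  exact hasFDerivAt_snd.comp_hasDerivWithinAt t (hγ t ht)

/-- The upper half plane is invariant. -/
theorem snd_pos (hk : Continuous k) (hγ : IsIntegralCurveOn γ (fun _ => planarField k) (Icc a b))
    (hc : c ∈ Icc a b) (h0 : 0 < (γ c).2) : ∀ t ∈ Icc a b, 0 < (γ t).2 := by
  have hfst : ContinuousOn (fun t => (γ t).1) (Icc a b) := continuous_fst.comp_continuousOn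
    hγ.continuousOn
  have hsnd : ContinuousOn (fun t => (γ t).2) (Icc a b) := continuous_snd.comp_continuousOn
    hγ.continuousOn
  have hne : ∀ t ∈ Icc a b, (γ t).2 ≠ 0 := by
    intro t ht hzero
    obtain ⟨R, hR⟩ := isCompact_Icc.exists_bound_of_continuousOn (hk.comp_continuousOn hfst)
    have := eqOn_Icc_of_hasDerivWithinAt (F := fun t y => y * k (γ t).1) (s := univ)
      (K := R.toNNReal) (γ := fun t => (γ t).2) (η := fun _ => 0) (fun s hs =>
        (LipschitzWith.of_dist_le_mul fun y y' => by
          rw [Real.dist_eq, Real.dist_eq, ← sub_mul, abs_mul, mul_comm]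
          exact mul_le_mul_of_nonneg_right ((hR s hs).trans (Real.le_coe_toNNReal R))
            (abs_nonneg _)).lipschitzOnWith)
      (fun s hs => hasDerivWithinAt_snd hγ hs) (fun _ _ => trivial)
      (fun s _ => by simpa using hasDerivWithinAt_const s (Icc a b) (0 : ℝ))
      (fun _ _ => trivial) ht hzero hc
    exact h0.ne' this
  intro t ht
  by_contra! hle
  obtain ⟨s, hs, hs0⟩ := isPreconnected_Icc.intermediate_value ht hc hsnd ⟨hle, h0.le⟩
  exact hne s hs hs0

/-- The derivative of `v / z` along an orbit is `z`. -/
theorem hasDerivWithinAt_div {s : Set ℝ} (hγ : IsIntegralCurveOn γ (fun _ => planarField k) s)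
    {t : ℝ} (ht : t ∈ s) (h0 : 0 < (γ t).2) :
    HasDerivWithinAt (fun t => (γ t).1 / (γ t).2) (γ t).2 s t := by
  have := (hasDerivWithinAt_fst hγ ht).fun_div (hasDerivWithinAt_snd hγ ht) h0.ne'
  refine this.congr_deriv ?_
  rw [div_eq_iff (pow_ne_zero 2 h0.ne')]
  ring

/-- An orbit that meets the graph of a solution of the truncated scalar equation stays on it while
`v` stays in the window of the truncation. -/
theorem snd_eq_of_isSol {d e : ℝ} {Z : ℝ → ℝ} {K : NNReal} (hK : LipschitzWith K (clamp k d e))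
    (hZ : IsSol (clamp k d e) Z)
    (hγ : IsIntegralCurveOn γ (fun _ => planarField k) (Icc a b))
    (hpos : ∀ t ∈ Icc a b, 0 < (γ t).2) (hwin : ∀ t ∈ Icc a b, (γ t).1 ∈ Icc d e)
    (hc : c ∈ Icc a b) (h : (γ c).2 = Z ((γ c).1 / (γ c).2)) :
    ∀ t ∈ Icc a b, (γ t).2 = Z ((γ t).1 / (γ t).2) := by
  refine eqOn_Icc_of_hasDerivWithinAt
    (F := fun t y => (γ t).2 * clamp k d e ((γ t).1 / (γ t).2 * y)) (s := univ)
    (K := K * (max |d| |e|).toNNReal) (γ := fun t => (γ t).2)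
    (η := fun t => Z ((γ t).1 / (γ t).2)) (fun t ht => ?_) (fun t ht => ?_) (fun _ _ => trivial)
    (fun t ht => ?_) (fun _ _ => trivial) hc h
  · refine (LipschitzWith.of_dist_le_mul fun y y' => ?_).lipschitzOnWith
    have hz := hpos t ht
    have h1 := hK.dist_le_mul ((γ t).1 / (γ t).2 * y) ((γ t).1 / (γ t).2 * y')
    rw [Real.dist_eq, Real.dist_eq, ← mul_sub, abs_mul, abs_div, abs_of_pos hz] at h1
    rw [Real.dist_eq, Real.dist_eq, ← mul_sub, abs_mul, abs_of_pos hz]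
    have h2 : |(γ t).1| ≤ max |d| |e| := abs_le_max_abs_abs (hwin t ht).1 (hwin t ht).2
    calc _ ≤ (γ t).2 * (K * (|(γ t).1| / (γ t).2 * |y - y'|)) := by gcongr
      _ = K * |(γ t).1| * |y - y'| := by field_simp
      _ ≤ K * max |d| |e| * |y - y'| := by gcongr
      _ ≤ _ := by
        push_cast
        gcongr
        exact Real.le_coe_toNNReal _
  · have h1 : (γ t).1 / (γ t).2 * (γ t).2 = (γ t).1 := div_mul_cancel₀ _ (hpos t ht).ne'
    simp only [h1, clamp_of_mem (hwin t ht)]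
    exact hasDerivWithinAt_snd hγ ht
  · have := (hZ ((γ t).1 / (γ t).2)).comp_hasDerivWithinAt t
      (hasDerivWithinAt_div hγ ht (hpos t ht))
    rwa [mul_comm] at this

/-- The graph of a solution of the scalar equation, run through with speed `du/dτ = Z(u)`, is an
orbit of the planar system. -/
theorem hasDerivAt_graph {Z u : ℝ → ℝ} {t : ℝ} (hu : HasDerivAt u (Z (u t)) t)
    (hZ : HasDerivAt Z (k (u t * Z (u t))) (u t)) :
    HasDerivAt (fun t => (u t * Z (u t), Z (u t))) (planarField k (u t * Z (u t), Z (u t))) t := by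
  have h2 := hZ.comp t hu
  have h1 := hu.fun_mul h2
  refine (h1.prodMk h2).congr_deriv (Prod.ext ?_ ?_)
  · simp only [planarField, Function.comp]
    ring
  · simp only [planarField]
    ring

theorem exists_autonomous_solution {Q : ℝ → ℝ} {K : NNReal} {M : ℝ} (hK : LipschitzWith K Q)
    (hM : ∀ y, |Q y| ≤ M) (u₀ : ℝ) : ∃ u : ℝ → ℝ, u 0 = u₀ ∧ ∀ t, HasDerivAt u (Q (u t)) t :=
  exists_global_solution (F := fun _ => Q) (fun _ => continuous_const) (fun _ => hM)
    (fun _ => ⟨K, fun _ _ => hK⟩) 0 u₀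

/-- A compact piece of the graph of a positive solution of the scalar equation is traversed in
finite time. -/
theorem exists_traverse {Z : ℝ → ℝ} {K : NNReal} (hK : LipschitzWith K Z) {u₀ u₁ : ℝ}
    (h01 : u₀ ≤ u₁) (hpos : ∀ u ∈ Icc u₀ u₁, 0 < Z u)
    (hZ : ∀ u ∈ Icc u₀ u₁, HasDerivAt Z (k (u * Z u)) u) :
    ∃ T ≥ 0, ∃ u : ℝ → ℝ, u 0 = u₀ ∧ u T = u₁ ∧ (∀ t ∈ Icc 0 T, u t ∈ Icc u₀ u₁) ∧
      IsIntegralCurveOn (fun t => (u t * Z (u t), Z (u t))) (fun _ => planarField k)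
        (Icc 0 T) := by
  have hmem : ∀ y, max u₀ (min u₁ y) ∈ Icc u₀ u₁ := fun y =>
    ⟨le_max_left _ _, max_le h01 (min_le_left _ _)⟩
  obtain ⟨w, hw, hmin⟩ := isCompact_Icc.exists_isMinOn (nonempty_Icc.2 h01)
    (hK.continuous.continuousOn (s := Icc u₀ u₁))
  obtain ⟨M, hM⟩ := isCompact_Icc.exists_bound_of_continuousOn
    (hK.continuous.continuousOn (s := Icc u₀ u₁))
  obtain ⟨u, hu0, hu⟩ := exists_autonomous_solution (Q := fun y => Z (max u₀ (min u₁ y)))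
    (hK.comp ((LipschitzWith.id.const_min u₁).const_max u₀)) (fun y => hM _ (hmem y)) u₀
  have hcont : Continuous u := continuous_iff_continuousAt.2 fun t => (hu t).continuousAt
  have hmono : Monotone u := monotone_of_deriv_nonneg (fun t => (hu t).differentiableAt)
    fun t => by rw [(hu t).deriv]; exact (hpos _ (hmem _)).le
  have hlow : ∀ t ≥ 0, u₀ + Z w * t ≤ u t := by
    intro t ht
    have := (convex_Icc 0 t).mul_sub_le_image_sub_of_le_deriv hcont.continuousOn
      (fun s _ => (hu s).differentiableAt.differentiableWithinAt) (C := Z w)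
      (fun s _ => by rw [(hu s).deriv]; exact hmin (hmem _)) 0 ⟨le_rfl, ht⟩ t ⟨ht, le_rfl⟩ ht
    rw [hu0] at this
    linarith
  have hZw := hpos w hw
  have hT0 : 0 ≤ (u₁ - u₀) / Z w := div_nonneg (by linarith) hZw.le
  obtain ⟨T, hT, huT⟩ : u₁ ∈ u '' Icc 0 ((u₁ - u₀) / Z w) := by
    refine intermediate_value_Icc hT0 hcont.continuousOn ⟨by rwa [hu0], ?_⟩
    have := hlow _ hT0
    rw [mul_div_cancel₀ _ hZw.ne'] at this
    linarith
  have hrange : ∀ t ∈ Icc 0 T, u t ∈ Icc u₀ u₁ := fun t ht =>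
    ⟨hu0 ▸ hmono ht.1, huT ▸ hmono ht.2⟩
  refine ⟨T, hT.1, u, hu0, huT, hrange, fun t ht => ?_⟩
  have h1 := hu t
  have h2 := hrange t ht
  rw [min_eq_right h2.2, max_eq_right h2.1] at h1
  exact (hasDerivAt_graph h1 (hZ _ h2)).hasDerivWithinAt

end

/-! ### The unstable separatrix as an orbit -/

/-- `γ` is, on `E`, the maximal solution of the autonomous system with field `F`: it solves the
system on the interval between `0` and any time of `E`, and every solution with the same value at
time `0` is a restriction of it. -/
structure IsMaximalSolution (F : ℝ × ℝ → ℝ × ℝ) (γ : ℝ → ℝ × ℝ) (E : Set ℝ) : Prop where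
  curve : ∀ τ ∈ E, IsIntegralCurveOn γ (fun _ => F) (uIcc 0 τ)
  maximal : ∀ τ η, η 0 = γ 0 → IsIntegralCurveOn η (fun _ => F) (uIcc 0 τ) →
    τ ∈ E ∧ EqOn η γ (uIcc 0 τ)

/-- The positive times up to which the solution exists with `dv/dτ > 0`. -/
def riseTimes (k : ℝ → ℝ) (γ : ℝ → ℝ × ℝ) (E : Set ℝ) : Set ℝ :=
  {τ | 0 < τ ∧ τ ∈ E ∧ ∀ s ∈ Icc 0 τ, 0 < (planarField k (γ s)).1}

section

variable {k : ℝ → ℝ} {r₁ r₂ r₃ : ℝ} {Z : ℝ → ℝ} {γ : ℝ → ℝ × ℝ} {E : Set ℝ}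

theorem IsSol.exists_lipschitzWith {h : ℝ → ℝ} {M : ℝ} (hZ : IsSol h Z) (hM : ∀ v, |h v| ≤ M) :
    ∃ K, LipschitzWith K Z := by
  refine ⟨M.toNNReal, lipschitzWith_of_nnnorm_deriv_le (fun x => (hZ x).differentiableAt)
    fun x => ?_⟩
  rw [(hZ x).deriv, ← NNReal.coe_le_coe, coe_nnnorm, Real.norm_eq_abs]
  exact (hM _).trans (Real.le_coe_toNNReal M)

/-- If `v` increases along a compact piece of the graph of a solution of the scalar equation, then
the orbit starting at the left end of the piece rises to its right end. -/
theorem IsMaximalSolution.exists_mem_riseTimes (hγ : IsMaximalSolution (planarField k) γ E)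
    {K : NNReal} (hK : LipschitzWith K Z) {u₀ u₁ : ℝ} (h0 : γ 0 = (u₀ * Z u₀, Z u₀))
    (h01 : u₀ < u₁) (hpos : ∀ u ∈ Icc u₀ u₁, 0 < Z u)
    (hZ : ∀ u ∈ Icc u₀ u₁, HasDerivAt Z (k (u * Z u)) u)
    (hgain : ∀ u ∈ Icc u₀ u₁, 0 < Z u + u * k (u * Z u)) :
    ∃ τ ∈ riseTimes k γ E, (γ τ).1 = u₁ * Z u₁ := by
  obtain ⟨T, hT, u, hu0, huT, hmem, hcurve⟩ := exists_traverse hK h01.le hpos hZ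
  have hT0 : 0 < T := hT.lt_of_ne (by rintro rfl; exact h01.ne (hu0.symm.trans huT))
  rw [← uIcc_of_le hT] at hcurve
  obtain ⟨hTE, heq⟩ := hγ.maximal T _ (by simp only [hu0, h0]) hcurve
  rw [uIcc_of_le hT] at heq
  refine ⟨T, ⟨hT0, hTE, fun s hs => ?_⟩, ?_⟩
  · rw [← heq hs]
    have h1 := hpos _ (hmem s hs)
    have h2 : (planarField k (u s * Z (u s), Z (u s))).1 =
        Z (u s) * (Z (u s) + u s * k (u s * Z (u s))) := by
      simp only [planarField]; ring
    rw [h2]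
    exact mul_pos h1 (hgain _ (hmem s hs))
  · rw [← heq ⟨hT, le_rfl⟩]
    simp only [huT]

theorem strictMonoOn_fst {τ : ℝ} (hγ : IsMaximalSolution (planarField k) γ E)
    (hτ : τ ∈ riseTimes k γ E) : StrictMonoOn (fun t => (γ t).1) (Icc 0 τ) := by
  have hc := hγ.curve τ hτ.2.1
  rw [uIcc_of_le hτ.1.le] at hc
  exact strictMonoOn_of_hasDerivWithinAt_pos (convex_Icc 0 τ)
    (continuous_fst.comp_continuousOn hc.continuousOn)
    (fun t ht => (hasDerivWithinAt_fst hc (interior_subset ht)).mono interior_subset)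
    fun t ht => hτ.2.2 t (interior_subset ht)

/-- An orbit of the upper half plane that tends to `(r₁, 0)` in backward time stays to the right of
`r₁`, because `v` increases where `v ≤ r₁`. -/
theorem lt_fst_of_tendsto (hr : IsRootTriple r₁ r₂ r₃)
    (hc : ∀ τ ≤ 0, IsIntegralCurveOn γ (fun _ => planarField (cubic r₁ r₂ r₃)) (Icc τ 0))
    (hpos : ∀ τ ≤ 0, 0 < (γ τ).2) (hlim : Tendsto γ atBot (𝓝 (r₁, 0))) :
    ∀ τ ≤ 0, r₁ < (γ τ).1 := by
  intro τ hτ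
  by_contra! hle
  have hback : ∀ s ≤ τ, (γ s).1 ≤ r₁ := by
    intro s hs
    by_contra! hlt
    have hsτ : s < τ := hs.lt_of_ne (by rintro rfl; linarith)
    have hc' := (hc s (hs.trans hτ)).mono (Icc_subset_Icc_right hτ)
    have := pos_of_deriv_pos_at_zeros' (W := fun t => (γ t).1 - r₁)
      (fun t ht => (hasDerivWithinAt_fst hc' ht).sub_const r₁) (by linarith)
      (fun t ht h0 => by
        have h1 : (γ t).1 = r₁ := by linarith
        have h2 := hpos t (ht.2.trans hτ)
        rw [h1, cubic, sub_self, zero_mul, zero_mul, mul_zero, zero_add]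
        positivity) τ ⟨hsτ, le_rfl⟩
    linarith
  have hmono : ∀ s < τ, StrictMonoOn (fun t => (γ t).1) (Icc s τ) := by
    intro s hs
    have hc' := (hc s (hs.le.trans hτ)).mono (Icc_subset_Icc_right hτ)
    refine strictMonoOn_of_hasDerivWithinAt_pos (convex_Icc s τ)
      (continuous_fst.comp_continuousOn hc'.continuousOn)
      (fun t ht => (hasDerivWithinAt_fst hc' (interior_subset ht)).mono interior_subset)
      fun t ht => ?_
    have ht' := interior_subset ht
    have h1 := hback t ht'.2
    have h2 := hpos t (ht'.2.trans hτ)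
    have h3 := mul_nonneg_of_nonpos_of_nonpos (h1.trans hr.neg.le) (cubic_nonpos_of_le hr h1)
    positivity
  have h1 : (γ (τ - 1)).1 < (γ τ).1 :=
    hmono (τ - 1) (by linarith) ⟨le_rfl, by linarith⟩ ⟨by linarith, le_rfl⟩ (by linarith)
  have h2 : r₁ ≤ (γ (τ - 1)).1 := by
    refine le_of_tendsto ((continuous_fst.tendsto _).comp hlim) ?_
    filter_upwards [eventually_lt_atBot (τ - 1)] with s hs
    exact (hmono s (by linarith) ⟨le_rfl, by linarith⟩ ⟨hs.le, by linarith⟩ hs).le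
  linarith

/-- An orbit that is to the left of `r₃` was so before. -/
theorem fst_lt_of_lt
    (hc : ∀ τ ≤ 0, IsIntegralCurveOn γ (fun _ => planarField (cubic r₁ r₂ r₃)) (Icc τ 0))
    (hpos : ∀ τ ≤ 0, 0 < (γ τ).2) (h0 : (γ 0).1 < r₃) : ∀ τ ≤ 0, (γ τ).1 < r₃ := by
  intro τ hτ
  by_contra! hle
  have hτ0 : τ < 0 := hτ.lt_of_ne (by rintro rfl; linarith)
  have := pos_of_deriv_pos_at_zeros' (W := fun t => (γ t).1 - r₃)
    (fun t ht => (hasDerivWithinAt_fst (hc τ hτ) ht).sub_const r₃) (by linarith)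
    (fun t ht h0 => by
      have h1 : (γ t).1 = r₃ := by linarith
      have h2 := hpos t ht.2
      rw [h1, cubic, sub_self, mul_zero, mul_zero, zero_add]
      positivity) 0 ⟨hτ0, le_rfl⟩
  linarith

/-- Orbits of the upper half plane that tend to `(r₁, 0)` in backward time lie on the graph of the
left separatrix. -/
theorem IsLeftSeparatrix.snd_eq (hr : IsRootTriple r₁ r₂ r₃) (hZ : IsLeftSeparatrix r₁ r₂ r₃ Z)
    (hc : ∀ τ ≤ 0, IsIntegralCurveOn γ (fun _ => planarField (cubic r₁ r₂ r₃)) (Icc τ 0))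
    (hz : 0 < (γ 0).2) (hlim : Tendsto γ atBot (𝓝 (r₁, 0))) (h0 : (γ 0).1 < r₃) :
    (γ 0).2 = Z ((γ 0).1 / (γ 0).2) := by
  have hpos : ∀ τ ≤ 0, 0 < (γ τ).2 := fun τ hτ =>
    snd_pos contDiff_cubic.continuous (hc τ hτ) ⟨hτ, le_rfl⟩ hz τ ⟨le_rfl, hτ⟩
  have hlow := lt_fst_of_tendsto hr hc hpos hlim
  have hupp := fst_lt_of_lt hc hpos h0
  obtain ⟨K, hK⟩ := (isTruncated_clampedCubic hr).lip
  obtain ⟨M, hM⟩ := (isTruncated_clampedCubic hr).bdd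
  obtain ⟨Y, hY, hY0⟩ := exists_isSol hK hM ((γ 0).1 / (γ 0).2) (γ 0).2
  have hgraph : ∀ τ ≤ 0, (γ τ).2 = Y ((γ τ).1 / (γ τ).2) := fun τ hτ =>
    snd_eq_of_isSol hK hY (hc τ hτ) (fun t ht => hpos t ht.2)
      (fun t ht => ⟨(hlow t ht.2).le, (hupp t ht.2).le⟩) (c := 0) ⟨hτ, le_rfl⟩ hY0.symm τ
      ⟨le_rfl, hτ⟩
  have hv : Tendsto (fun τ => (γ τ).1) atBot (𝓝 r₁) := (continuous_fst.tendsto _).comp hlim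
  have hz0 : Tendsto (fun τ => (γ τ).2) atBot (𝓝[>] 0) :=
    tendsto_nhdsWithin_iff.2 ⟨(continuous_snd.tendsto _).comp hlim,
      (eventually_le_atBot 0).mono hpos⟩
  have hu : Tendsto (fun τ => (γ τ).1 / (γ τ).2) atBot atBot := by
    simpa only [div_eq_mul_inv, Function.comp_def] using
      hv.neg_mul_atTop hr.neg (tendsto_inv_nhdsGT_zero.comp hz0)
  have hucont : ∀ τ ≤ 0, ContinuousOn (fun τ => (γ τ).1 / (γ τ).2) (Icc τ 0) := fun τ hτ t ht =>
    (hasDerivWithinAt_div (hc τ hτ) ht (hpos t ht.2)).continuousWithinAt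
  have hYlim : Tendsto (fun u => u * Y u) atBot (𝓝 r₁) := by
    intro N hN
    obtain ⟨T, hT⟩ := (hv.eventually hN).exists_forall_of_atBot
    have hT0 : min T 0 ≤ 0 := min_le_right _ _
    refine mem_map.2 (mem_of_superset (Iic_mem_atBot ((γ (min T 0)).1 / (γ (min T 0)).2)) ?_)
    intro U hU
    obtain ⟨τ', hτU, hτT⟩ := ((hu.eventually (eventually_le_atBot U)).and
      (eventually_le_atBot (min T 0))).exists
    obtain ⟨τ, hτ, hτu⟩ := intermediate_value_Icc hτT
      ((hucont τ' (hτT.trans hT0)).mono (Icc_subset_Icc_right hT0)) ⟨hτU, hU⟩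
    have hτ0 : τ ≤ 0 := hτ.2.trans hT0
    have h1 : U * Y U = (γ τ).1 := by
      rw [← hτu]
      simp only
      rw [← hgraph τ hτ0, div_mul_cancel₀ _ (hpos τ hτ0).ne']
    rw [mem_preimage, h1]
    exact hT τ (hτ.2.trans (min_le_left _ _))
  rw [← hZ.unique Y hY hYlim, hY0]

/-- The left separatrix is the graph of an orbit near the saddle. -/
theorem IsLeftSeparatrix.exists_orbit (hr : IsRootTriple r₁ r₂ r₃)
    (hZ : IsLeftSeparatrix r₁ r₂ r₃ Z) :
    ∃ γ : ℝ → ℝ × ℝ, IsIntegralCurveOn γ (fun _ => planarField (cubic r₁ r₂ r₃)) (Iic 0) ∧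
      Tendsto γ atBot (𝓝 (r₁, 0)) ∧ 0 < (γ 0).2 ∧ r₁ < (γ 0).1 ∧ (γ 0).1 < r₂ ∧
      0 < (planarField (cubic r₁ r₂ r₃) (γ 0)).1 := by
  obtain ⟨M, hM⟩ := (isTruncated_clampedCubic hr).bdd
  obtain ⟨K, hK⟩ := hZ.sol.exists_lipschitzWith hM
  obtain ⟨u₀, hu₀⟩ := ((hZ.tendsto.eventually (gt_mem_nhds (lt_min hr.lt₁₂ hr.neg))).and
    (eventually_lt_atBot 0)).exists_forall_of_atBot
  have hu₀0 : u₀ < 0 := (hu₀ u₀ le_rfl).2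
  have hpos : ∀ u ≤ u₀, 0 < Z u := by
    intro u hu
    obtain ⟨h1, h2⟩ := hu₀ u hu
    by_contra! hle
    have := mul_nonneg_of_nonpos_of_nonpos h2.le hle
    linarith [h1.trans_le (min_le_right r₂ 0)]
  have hbound : ∀ y, |Z (min u₀ y)| ≤ -r₁ / -u₀ := by
    intro y
    have h1 : min u₀ y ≤ u₀ := min_le_left _ _
    have h2 := hpos _ h1
    rw [abs_of_pos h2, le_div_iff₀ (neg_pos.2 hu₀0)]
    nlinarith [hZ.lt _ (h1.trans_lt hu₀0)]
  obtain ⟨u, hu0, hu⟩ := exists_autonomous_solution (Q := fun y => Z (min u₀ y))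
    (hK.comp (LipschitzWith.id.const_min u₀)) hbound u₀
  have hmono : Monotone u := monotone_of_deriv_nonneg (fun t => (hu t).differentiableAt)
    fun t => by rw [(hu t).deriv]; exact (hpos _ (min_le_left _ _)).le
  have hle : ∀ t ≤ 0, u t ≤ u₀ := fun t ht => hu0 ▸ hmono ht
  have hbot : Tendsto u atBot atBot := by
    refine tendsto_atBot_atBot_of_monotone hmono fun B => ?_
    by_contra! hB
    obtain ⟨w, hw, hmin⟩ := isCompact_Icc.exists_isMinOn (nonempty_Icc.2 (hu0 ▸ (hB 0).le))
      (hK.continuous.continuousOn (s := Icc B u₀))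
    have hZw := hpos w hw.2
    have ht : -(u₀ - B) / Z w ≤ 0 :=
      div_nonpos_of_nonpos_of_nonneg (by linarith [hu0 ▸ hB 0]) hZw.le
    have := (convex_Icc (-(u₀ - B) / Z w) 0).mul_sub_le_image_sub_of_le_deriv (f := u)
      (fun s _ => (hu s).continuousAt.continuousWithinAt)
      (fun s _ => (hu s).differentiableAt.differentiableWithinAt) (C := Z w)
      (fun s hs => by
        have hs' := interior_subset hs
        rw [(hu s).deriv, min_eq_right (hle s hs'.2)]
        exact hmin ⟨(hB s).le, hle s hs'.2⟩) _ ⟨le_rfl, ht⟩ 0 ⟨ht, le_rfl⟩ ht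
    rw [hu0, zero_sub, mul_neg, mul_div_cancel₀ _ hZw.ne'] at this
    linarith [hB (-(u₀ - B) / Z w)]
  have hv0 := hu₀ u₀ le_rfl
  have hlt0 : u₀ * Z u₀ < r₂ := hv0.1.trans_le (min_le_left _ _)
  have hder : ∀ t ≤ 0, HasDerivAt Z (cubic r₁ r₂ r₃ (u t * Z (u t))) (u t) := by
    intro t ht
    have h1 := hu₀ _ (hle t ht)
    rw [← clampedCubic_of_mem ⟨(hZ.lt _ h1.2).le,
      (h1.1.trans_le (min_le_right _ _)).le.trans hr.pos.le⟩]
    exact hZ.sol (u t)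
  refine ⟨fun t => (u t * Z (u t), Z (u t)), fun t ht => ?_, ?_, ?_, ?_, ?_, ?_⟩
  · have h1 := hu t
    rw [min_eq_right (hle t ht)] at h1
    exact (hasDerivAt_graph h1 (hder t ht)).hasDerivWithinAt
  · refine (hZ.tendsto.comp hbot).prodMk_nhds ?_
    have : Tendsto Z atBot (𝓝 0) := by
      refine (hZ.tendsto.div_atBot tendsto_id).congr' ?_
      filter_upwards [eventually_lt_atBot 0] with x hx
      exact mul_div_cancel_left₀ _ hx.ne
    exact this.comp hbot
  · simpa only [hu0] using hpos u₀ le_rfl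
  · simpa only [hu0] using hZ.lt u₀ hu₀0
  · simpa only [hu0] using hlt0
  · have h1 := hZ.gain_pos_of_neg u₀ hu₀0 (hpos u₀ le_rfl)
    rw [gain, clampedCubic_of_mem ⟨(hZ.lt u₀ hu₀0).le, (hlt0.trans hr.lt₂₃).le⟩] at h1
    have h2 : (planarField (cubic r₁ r₂ r₃) (u₀ * Z u₀, Z u₀)).1 =
        Z u₀ * (Z u₀ + u₀ * cubic r₁ r₂ r₃ (u₀ * Z u₀)) := by
      simp only [planarField]; ring
    simp only [hu0, h2]
    exact mul_pos (hpos u₀ le_rfl) h1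

end

/-! ### The endpoint of the rising arc -/

/-- `γ` is a maximal solution starting at the point `u₀` of the graph of `Z`, between the zeros
`r₁` and `r₂`, with `v` increasing there. -/
structure StartsOn (r₁ r₂ r₃ : ℝ) (Z : ℝ → ℝ) (γ : ℝ → ℝ × ℝ) (E : Set ℝ) (u₀ : ℝ) : Prop where
  max : IsMaximalSolution (planarField (cubic r₁ r₂ r₃)) γ E
  start : γ 0 = (u₀ * Z u₀, Z u₀)
  pos : 0 < Z u₀
  lt : r₁ < u₀ * Z u₀
  le : u₀ * Z u₀ ≤ r₂
  gain_pos : 0 < gain (clampedCubic r₁ r₂ r₃) Z u₀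

/-- The points of the graph of `Z` in the upper half plane and in the window of the truncation at
which `v` increases. -/
def risingSet (r₁ r₂ r₃ : ℝ) (Z : ℝ → ℝ) : Set ℝ :=
  {u | 0 < Z u ∧ u * Z u ∈ Icc r₁ r₃ ∧ 0 < gain (clampedCubic r₁ r₂ r₃) Z u}

section

variable {r₁ r₂ r₃ : ℝ} {Z : ℝ → ℝ} {γ : ℝ → ℝ × ℝ} {E : Set ℝ} {u₀ : ℝ}

theorem StartsOn.fst_zero (hγ : StartsOn r₁ r₂ r₃ Z γ E u₀) : (γ 0).1 = u₀ * Z u₀ := by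
  rw [hγ.start]

theorem StartsOn.exists_mem_riseTimes (hr : IsRootTriple r₁ r₂ r₃)
    (hZ : IsSol (clampedCubic r₁ r₂ r₃) Z) (hγ : StartsOn r₁ r₂ r₃ Z γ E u₀) {u₁ : ℝ}
    (h01 : u₀ < u₁) (h : ∀ u ∈ Icc u₀ u₁, u ∈ risingSet r₁ r₂ r₃ Z) :
    ∃ τ ∈ riseTimes (cubic r₁ r₂ r₃) γ E, (γ τ).1 = u₁ * Z u₁ := by
  obtain ⟨M, hM⟩ := (isTruncated_clampedCubic hr).bdd
  obtain ⟨K, hK⟩ := hZ.exists_lipschitzWith hM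
  refine hγ.max.exists_mem_riseTimes hK hγ.start h01 (fun u hu => (h u hu).1)
    (fun u hu => ?_) fun u hu => ?_
  · rw [← clampedCubic_of_mem (h u hu).2.1]
    exact hZ u
  · rw [← clampedCubic_of_mem (h u hu).2.1]
    exact (h u hu).2.2

/-- If the graph rises up to, and not necessarily including, `u₁`, then the orbit attains values
of `v` arbitrarily close to the one at `u₁`. -/
theorem StartsOn.exists_lt_fst (hr : IsRootTriple r₁ r₂ r₃)
    (hZ : IsSol (clampedCubic r₁ r₂ r₃) Z) (hγ : StartsOn r₁ r₂ r₃ Z γ E u₀) {u₁ c : ℝ}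
    (h01 : u₀ < u₁) (h : ∀ u ∈ Ico u₀ u₁, u ∈ risingSet r₁ r₂ r₃ Z) (hc : c < u₁ * Z u₁) :
    ∃ τ ∈ riseTimes (cubic r₁ r₂ r₃) γ E, c < (γ τ).1 := by
  have hev : ∀ᶠ u in 𝓝[<] u₁, c < u * Z u :=
    (hZ.continuous_mul.continuousAt.mono_left nhdsWithin_le_nhds).eventually (lt_mem_nhds hc)
  obtain ⟨u, hcu, hu⟩ := (hev.and (Ioo_mem_nhdsLT h01)).exists
  obtain ⟨τ, hτ, hv⟩ := hγ.exists_mem_riseTimes hr hZ hu.1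
    fun w hw => h w ⟨hw.1, hw.2.trans_lt hu.2⟩
  exact ⟨τ, hτ, hv ▸ hcu⟩

/-- Every value `e ≤ r₃` of `v` passed on the rising arc is attained at a point of the graph at
which `v` increases. -/
theorem StartsOn.exists_mul_eq (hr : IsRootTriple r₁ r₂ r₃)
    (hZ : IsSol (clampedCubic r₁ r₂ r₃) Z) (hγ : StartsOn r₁ r₂ r₃ Z γ E u₀) {τ e : ℝ}
    (hτ : τ ∈ riseTimes (cubic r₁ r₂ r₃) γ E) (h0e : u₀ * Z u₀ ≤ e) (he : e ≤ (γ τ).1)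
    (her : e ≤ r₃) :
    ∃ u ≥ u₀, 0 < Z u ∧ u * Z u = e ∧ 0 < gain (clampedCubic r₁ r₂ r₃) Z u := by
  obtain ⟨K, hK⟩ := (isTruncated_clampedCubic hr).lip
  have hmono := strictMonoOn_fst hγ.max hτ
  have hcurve := hγ.max.curve τ hτ.2.1
  rw [uIcc_of_le hτ.1.le] at hcurve
  obtain ⟨s, hs, hse⟩ : e ∈ (fun t => (γ t).1) '' Icc 0 τ :=
    intermediate_value_Icc hτ.1.le (continuous_fst.comp_continuousOn hcurve.continuousOn)
      ⟨hγ.fst_zero.trans_le h0e, he⟩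
  simp only at hse
  have hs0 : (0 : ℝ) ∈ Icc 0 s := ⟨le_rfl, hs.1⟩
  have hsub : Icc 0 s ⊆ Icc 0 τ := Icc_subset_Icc_right hs.2
  have hcs := hcurve.mono hsub
  have hpos := snd_pos contDiff_cubic.continuous hcs hs0 (by rw [hγ.start]; exact hγ.pos)
  have hu0 : (γ 0).1 / (γ 0).2 = u₀ := by
    rw [hγ.start]; exact mul_div_cancel_right₀ _ hγ.pos.ne'
  have hwin : ∀ t ∈ Icc 0 s, (γ t).1 ∈ Icc r₁ r₃ := by
    intro t ht
    have h1 := hmono.monotoneOn (hsub hs0) (hsub ht) ht.1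
    have h2 := hmono.monotoneOn (hsub ht) hs ht.2
    simp only [hγ.fst_zero] at h1
    exact ⟨hγ.lt.le.trans h1, h2.trans (hse.trans_le her)⟩
  have hgraph := snd_eq_of_isSol hK hZ hcs hpos hwin hs0 (by rw [hu0, hγ.start]) s
    ⟨hs.1, le_rfl⟩
  have humono : MonotoneOn (fun t => (γ t).1 / (γ t).2) (Icc 0 s) :=
    monotoneOn_of_hasDerivWithinAt_nonneg (convex_Icc 0 s)
      (fun t ht => (hasDerivWithinAt_div hcs ht (hpos t ht)).continuousWithinAt)
      (fun t ht => (hasDerivWithinAt_div hcs (interior_subset ht)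
        (hpos t (interior_subset ht))).mono interior_subset)
      fun t ht => (hpos t (interior_subset ht)).le
  have hzs := hpos s ⟨hs.1, le_rfl⟩
  have hmul : (γ s).1 / (γ s).2 * Z ((γ s).1 / (γ s).2) = (γ s).1 := by
    rw [← hgraph, div_mul_cancel₀ _ hzs.ne']
  refine ⟨(γ s).1 / (γ s).2, ?_, hgraph ▸ hzs, hmul.trans hse, ?_⟩
  · have := humono hs0 ⟨hs.1, le_rfl⟩ hs.1
    simpa only [hu0] using this
  · have h1 := hτ.2.2 s hs
    rw [gain, hmul, ← hgraph, clampedCubic_of_mem (hwin s ⟨hs.1, le_rfl⟩)]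
    have h2 : (planarField (cubic r₁ r₂ r₃) (γ s)).1 =
        (γ s).2 * ((γ s).2 + (γ s).1 / (γ s).2 * cubic r₁ r₂ r₃ (γ s).1) := by
      simp only [planarField]
      field_simp
      ring
    rw [h2] at h1
    exact (pos_iff_pos_of_mul_pos h1).1 hzs

theorem isLUB_image_coe {ι : Type*} {S : Set ι} {v : ι → ℝ} {e : ℝ} (hup : ∀ τ ∈ S, v τ ≤ e)
    (hlow : ∀ c < e, ∃ τ ∈ S, c < v τ) : IsLUB ((fun τ => (v τ : EReal)) '' S) (e : EReal) := by
  refine ⟨?_, fun B hB => ?_⟩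
  · rintro _ ⟨τ, hτ, rfl⟩
    exact EReal.coe_le_coe_iff.2 (hup τ hτ)
  · by_contra! hlt
    obtain ⟨c, hBc, hce⟩ := EReal.lt_iff_exists_real_btwn.1 hlt
    obtain ⟨τ, hτ, hc⟩ := hlow c (EReal.coe_lt_coe_iff.1 hce)
    exact absurd (hB ⟨τ, hτ, rfl⟩) (not_le.2 (hBc.trans (EReal.coe_lt_coe_iff.2 hc)))

theorem isLUB_image_coe_top {ι : Type*} {S : Set ι} {v : ι → ℝ} (h : ∀ c, ∃ τ ∈ S, c < v τ) :
    IsLUB ((fun τ => (v τ : EReal)) '' S) ⊤ := by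
  refine ⟨fun _ _ => le_top, fun B hB => ?_⟩
  by_contra! hlt
  obtain ⟨c, hBc, -⟩ := EReal.lt_iff_exists_real_btwn.1 hlt
  obtain ⟨τ, hτ, hc⟩ := h c
  exact absurd (hB ⟨τ, hτ, rfl⟩) (not_le.2 (hBc.trans (EReal.coe_lt_coe_iff.2 hc)))

/-! ### Signs along solutions of the scalar equation -/

theorem clampedCubic_zero (hr : IsRootTriple r₁ r₂ r₃) :
    clampedCubic r₁ r₂ r₃ 0 = -(r₁ * r₃) * r₂ := by
  rw [clampedCubic_of_mem ⟨hr.neg.le, hr.pos.le⟩, cubic]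
  ring

/-- If `r₂ < 0`, solutions cross zero only downwards. -/
theorem IsSol.pos_of_le (hr : IsRootTriple r₁ r₂ r₃) (h₂ : r₂ < 0)
    (hZ : IsSol (clampedCubic r₁ r₂ r₃) Z) {u : ℝ} (hu : 0 < Z u) {w : ℝ} (hw : w ≤ u) :
    0 < Z w := by
  have := pos_of_deriv_pos_at_zeros (a := -u) (b := -w) (fun x _ => (hZ.reflect x).hasDerivWithinAt)
    (by simpa using hu) (fun x _ h0 => by
      simp only [h0, mul_zero, neg_zero, clampedCubic_zero hr]
      nlinarith [mul_pos (mul_pos (neg_pos.2 hr.neg) hr.pos) (neg_pos.2 h₂)]) (-w)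
    ⟨neg_le_neg hw, le_rfl⟩
  simpa using this

/-- If `r₂ > 0`, solutions cross zero only upwards. -/
theorem IsSol.pos_of_ge (hr : IsRootTriple r₁ r₂ r₃) (h₂ : 0 < r₂)
    (hZ : IsSol (clampedCubic r₁ r₂ r₃) Z) {u : ℝ} (hu : 0 < Z u) {w : ℝ} (hw : u ≤ w) :
    0 < Z w :=
  pos_of_deriv_pos_at_zeros (a := u) (b := w) (fun x _ => (hZ x).hasDerivWithinAt)
    hu (fun x _ h0 => by
      rw [h0, mul_zero, clampedCubic_zero hr]
      nlinarith [mul_pos (mul_pos (neg_pos.2 hr.neg) hr.pos) h₂]) w ⟨hw, le_rfl⟩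

theorem IsLeftSeparatrix.exists_pos (hr : IsRootTriple r₁ r₂ r₃)
    (hZ : IsLeftSeparatrix r₁ r₂ r₃ Z) (u : ℝ) : ∃ w ≤ u, 0 < Z w := by
  obtain ⟨w, h1, h2, h3⟩ := ((hZ.tendsto.eventually (gt_mem_nhds hr.neg)).and
    ((eventually_le_atBot u).and (eventually_lt_atBot 0))).exists
  refine ⟨w, h2, ?_⟩
  by_contra! hle
  linarith [mul_nonneg_of_nonpos_of_nonpos h3.le hle]

theorem IsLeftSeparatrix.pos (hr : IsRootTriple r₁ r₂ r₃) (hZ : IsLeftSeparatrix r₁ r₂ r₃ Z)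
    (h₂ : 0 < r₂) (u : ℝ) : 0 < Z u := by
  obtain ⟨w, hw, hZw⟩ := hZ.exists_pos hr u
  exact hZ.sol.pos_of_ge hr h₂ hZw hw

/-- A left separatrix that is positive at `u ≥ 0` is positive at smaller arguments. -/
theorem IsLeftSeparatrix.pos_of_le (hr : IsRootTriple r₁ r₂ r₃)
    (hZ : IsLeftSeparatrix r₁ r₂ r₃ Z) {u : ℝ} (hu : 0 < Z u) {w : ℝ} (hw : w ≤ u) : 0 < Z w := by
  rcases hr.ne.lt_or_gt with h₂ | h₂
  · exact hZ.sol.pos_of_le hr h₂ hu hw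
  · exact hZ.pos hr h₂ w

theorem IsLeftSeparatrix.mem_risingSet_of_neg (hr : IsRootTriple r₁ r₂ r₃)
    (hZ : IsLeftSeparatrix r₁ r₂ r₃ Z) {u : ℝ} (hu : u < 0) (hpos : 0 < Z u) :
    u ∈ risingSet r₁ r₂ r₃ Z :=
  ⟨hpos, ⟨(hZ.lt u hu).le, (mul_neg_of_neg_of_pos hu hpos).le.trans hr.pos.le⟩,
    hZ.gain_pos_of_neg u hu hpos⟩

theorem zero_mem_risingSet (hr : IsRootTriple r₁ r₂ r₃) (hpos : 0 < Z 0) :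
    (0 : ℝ) ∈ risingSet r₁ r₂ r₃ Z :=
  ⟨hpos, by simpa using ⟨hr.neg.le, hr.pos.le⟩, by simpa [gain] using hpos⟩

/-- A left separatrix that is positive at `0` rises over `(-∞, 0]`. -/
theorem IsLeftSeparatrix.mem_risingSet_of_nonpos (hr : IsRootTriple r₁ r₂ r₃)
    (hZ : IsLeftSeparatrix r₁ r₂ r₃ Z) (h0 : 0 < Z 0) {u : ℝ} (hu : u ≤ 0) :
    u ∈ risingSet r₁ r₂ r₃ Z := by
  rcases hu.lt_or_eq with h | rfl
  · exact hZ.mem_risingSet_of_neg hr h (hZ.pos_of_le hr h0 hu)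
  · exact zero_mem_risingSet hr h0

/-! ### The four positions of the left separatrix -/

/-- If the left separatrix is not positive at `0`, the rising arc ends at the origin. -/
theorem IsLeftSeparatrix.isLUB_of_nonpos (hr : IsRootTriple r₁ r₂ r₃)
    (hZ : IsLeftSeparatrix r₁ r₂ r₃ Z) (h0 : Z 0 ≤ 0) (hγ : StartsOn r₁ r₂ r₃ Z γ E u₀) :
    IsLUB ((fun τ => ((γ τ).1 : EReal)) '' riseTimes (cubic r₁ r₂ r₃) γ E) ((0 : ℝ) : EReal) := by
  have h₂ : r₂ < 0 := hr.ne.lt_or_gt.resolve_right fun h₂ => absurd (hZ.pos hr h₂ 0) (not_lt.2 h0)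
  have hu₀v : u₀ * Z u₀ < 0 := hγ.le.trans_lt h₂
  have hu₀ : u₀ < 0 := by
    by_contra! hle
    linarith [mul_nonneg hle hγ.pos.le]
  have hcl : IsClosed (Icc u₀ 0 ∩ Z ⁻¹' Iic 0) :=
    isClosed_Icc.inter (isClosed_Iic.preimage hZ.sol.continuous)
  obtain ⟨w, ⟨hw, hZw⟩, hmin⟩ := (isCompact_Icc.of_isClosed_subset hcl
    inter_subset_left).exists_isLeast ⟨0, ⟨hu₀.le, le_rfl⟩, h0⟩
  have hlt : u₀ < w := hw.1.lt_of_ne (by rintro rfl; exact absurd hZw (not_le.2 hγ.pos))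
  refine isLUB_image_coe (fun τ hτ => ?_) fun c hc => ?_
  · by_contra! hlt'
    obtain ⟨u, -, hu, huv, -⟩ := hγ.exists_mul_eq hr hZ.sol hτ hu₀v.le hlt'.le hr.pos.le
    rcases mul_eq_zero.1 huv with rfl | h
    · linarith
    · linarith
  · refine hγ.exists_lt_fst hr hZ.sol hlt (fun u hu => ?_)
      (hc.trans_le (mul_nonneg_of_nonpos_of_nonpos hw.2 hZw))
    have huw : u < 0 := hu.2.trans_le hw.2
    refine hZ.mem_risingSet_of_neg hr huw ?_
    by_contra! hle
    exact absurd (hmin ⟨⟨hu.1, huw.le⟩, hle⟩) (not_le.2 hu.2)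

/-- If the two separatrices coincide, the rising arc ends at `(r₃, 0)`. -/
theorem IsLeftSeparatrix.isLUB_of_eq (hr : IsRootTriple r₁ r₂ r₃)
    (hZ : IsLeftSeparatrix r₁ r₂ r₃ Z) (h0 : 0 < Z 0) (hcon : Z 0 = cubicThreshold r₁ r₂ r₃)
    (hγ : StartsOn r₁ r₂ r₃ Z γ E u₀) :
    IsLUB ((fun τ => ((γ τ).1 : EReal)) '' riseTimes (cubic r₁ r₂ r₃) γ E) (r₃ : EReal) := by
  have hT := isTruncated_clampedCubic hr
  have hlim := hT.tendsto_mul hZ.sol hcon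
  have hpos : ∀ u, 0 < Z u := by
    intro u
    obtain ⟨w, h1, h2, h3⟩ := ((hlim.eventually (lt_mem_nhds hr.pos)).and
      ((eventually_ge_atTop u).and (eventually_gt_atTop 0))).exists
    exact hZ.pos_of_le hr ((pos_iff_pos_of_mul_pos h1).1 h3) h2
  have hrise : ∀ u, u ∈ risingSet r₁ r₂ r₃ Z := by
    intro u
    rcases le_or_gt u 0 with hu | hu
    · exact hZ.mem_risingSet_of_nonpos hr h0 hu
    · have hv := mul_pos hu (hpos u)
      exact ⟨hpos u, ⟨hr.neg.le.trans hv.le, (hT.mul_lt_of_le_threshold hZ.sol hcon.le hu).le⟩,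
        hT.gain_pos hZ.sol hcon hu hv⟩
  refine isLUB_image_coe (fun τ hτ => ?_) fun c hc => ?_
  · by_contra! hlt
    obtain ⟨u, -, hu, huv, -⟩ := hγ.exists_mul_eq hr hZ.sol hτ (hγ.le.trans hr.lt₂₃.le) hlt.le
      le_rfl
    have hu0 : 0 < u := (pos_iff_pos_of_mul_pos (huv ▸ hr.pos)).2 hu
    linarith [hT.mul_lt_of_le_threshold hZ.sol hcon.le hu0]
  · obtain ⟨u, hcu, hu⟩ := ((hlim.eventually (lt_mem_nhds hc)).and
      (eventually_gt_atTop u₀)).exists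
    exact hγ.exists_lt_fst hr hZ.sol hu (fun w _ => hrise w) hcu

/-- If the left separatrix is positive at `0` and below the right one, the rising arc ends between
`max 0 r₂` and `r₃`, at the first point where `v` stops increasing. -/
theorem IsLeftSeparatrix.exists_isLUB_of_lt (hr : IsRootTriple r₁ r₂ r₃)
    (hZ : IsLeftSeparatrix r₁ r₂ r₃ Z) (h0 : 0 < Z 0) (hlt : Z 0 < cubicThreshold r₁ r₂ r₃) :
    ∃ e : ℝ, max 0 r₂ < e ∧ e < r₃ ∧ ∀ γ E u₀, StartsOn r₁ r₂ r₃ Z γ E u₀ →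
      IsLUB ((fun τ => ((γ τ).1 : EReal)) '' riseTimes (cubic r₁ r₂ r₃) γ E) (e : EReal) := by
  have hT := isTruncated_clampedCubic hr
  obtain ⟨K, hK⟩ := hT.lip
  have hbelow : ∀ u, 0 < u → u * Z u < r₃ := fun u hu =>
    hT.mul_lt_of_le_threshold hZ.sol hlt.le hu
  have hcubic : ∀ v, 0 ≤ v → v ≤ r₂ → 0 ≤ clampedCubic r₁ r₂ r₃ v := by
    intro v hv hv₂
    rw [clampedCubic_of_mem ⟨hr.neg.le.trans hv, hv₂.trans hr.lt₂₃.le⟩]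
    rcases hv₂.lt_or_eq with h | rfl
    · exact (cubic_pos_of_mem hr (hr.neg.trans_le hv) h).le
    · simp [cubic]
  obtain ⟨x₀, hx₀, hvx₀⟩ : ∃ x > 0, r₂ < x * Z x := by
    rcases hr.ne.lt_or_gt with h₂ | h₂
    · obtain ⟨x, hZx, hx⟩ := (((hZ.sol.continuous.continuousAt.mono_left
        nhdsWithin_le_nhds).eventually (lt_mem_nhds h0)).and
        (self_mem_nhdsWithin : Ioi (0 : ℝ) ∈ 𝓝[>] 0)).exists
      exact ⟨x, hx, h₂.trans (mul_pos hx hZx)⟩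
    · by_contra! hcon
      have hmono : MonotoneOn Z (Ici 0) := by
        refine monotoneOn_of_deriv_nonneg (convex_Ici 0) hZ.sol.continuous.continuousOn
          (fun x _ => (hZ.sol x).differentiableAt.differentiableWithinAt) fun x hx => ?_
        rw [interior_Ici] at hx
        rw [(hZ.sol x).deriv]
        exact hcubic _ (mul_pos hx (hZ.pos hr h₂ x)).le (hcon x hx)
      have hx : 0 < r₂ / Z 0 + 1 := by positivity
      have h1 := hmono self_mem_Ici hx.le hx.le
      have h2 : (r₂ / Z 0 + 1) * Z 0 = r₂ + Z 0 := by field_simp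
      nlinarith [hcon _ hx, mul_le_mul_of_nonneg_left h1 hx.le]
  obtain ⟨x, hx, hgx⟩ := hT.exists_gain_nonpos hZ.sol hlt hx₀ hvx₀
  have hx0 : 0 < x := hx₀.trans_le hx
  have hcl : IsClosed (Icc 0 x ∩ gain (clampedCubic r₁ r₂ r₃) Z ⁻¹' Iic 0) :=
    isClosed_Icc.inter (isClosed_Iic.preimage (hZ.sol.continuous_gain hK.continuous))
  obtain ⟨u₁, ⟨hu₁, hg₁⟩, hmin⟩ := (isCompact_Icc.of_isClosed_subset hcl
    inter_subset_left).exists_isLeast ⟨x, ⟨hx0.le, le_rfl⟩, hgx⟩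
  have hg0 : 0 < gain (clampedCubic r₁ r₂ r₃) Z 0 := by simpa [gain] using h0
  have hu₁0 : 0 < u₁ := hu₁.1.lt_of_ne (by rintro rfl; exact absurd hg₁ (not_le.2 hg0))
  have hgain : ∀ u ∈ Ico 0 u₁, 0 < gain (clampedCubic r₁ r₂ r₃) Z u := by
    intro u hu
    by_contra! hle
    exact absurd (hmin ⟨⟨hu.1, hu.2.le.trans hu₁.2⟩, hle⟩) (not_le.2 hu.2)
  have hmono : StrictMonoOn (fun u => u * Z u) (Icc 0 u₁) := by
    refine strictMonoOn_of_deriv_pos (convex_Icc 0 u₁) hZ.sol.continuous_mul.continuousOn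
      fun u hu => ?_
    rw [interior_Icc] at hu
    rw [(hZ.sol.hasDerivAt_mul u).deriv]
    exact hgain u ⟨hu.1.le, hu.2⟩
  have hvpos : ∀ u ∈ Ioc 0 u₁, 0 < u * Z u := by
    intro u hu
    have := hmono ⟨le_rfl, hu₁0.le⟩ ⟨hu.1.le, hu.2⟩ hu.1
    simpa using this
  have he0 := hvpos u₁ ⟨hu₁0, le_rfl⟩
  have he₂ : r₂ < u₁ * Z u₁ := by
    by_contra! hle
    have h1 := barrier_of_gain_nonpos hu₁0 hg₁
    have h2 := hcubic _ he0.le hle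
    have h3 : 0 < u₁ * Z u₁ / u₁ ^ 2 := by positivity
    linarith
  have he₃ := hbelow u₁ hu₁0
  have hrise : ∀ u < u₁, u ∈ risingSet r₁ r₂ r₃ Z := by
    intro u hu
    rcases le_or_gt u 0 with h | h
    · exact hZ.mem_risingSet_of_nonpos hr h0 h
    · have hv := hvpos u ⟨h, hu.le⟩
      exact ⟨(pos_iff_pos_of_mul_pos hv).1 h, ⟨hr.neg.le.trans hv.le, (hbelow u h).le⟩,
        hgain u ⟨h.le, hu⟩⟩
  refine ⟨u₁ * Z u₁, max_lt he0 he₂, he₃, fun γ E u₀ hγ => ?_⟩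
  -- After `u₁`, the product `u Z` does not come back below `r₂`, so the orbit starts before `u₁`.
  have hu₀₁ : u₀ < u₁ := by
    by_contra! hle
    have hu₀0 : 0 < u₀ := hu₁0.trans_le hle
    have h₂ : 0 < r₂ := (mul_pos hu₀0 hγ.pos).trans_le hγ.le
    rcases hle.lt_or_eq with h | h
    · have hzero : clampedCubic r₁ r₂ r₃ r₂ = 0 := by
        rw [clampedCubic_of_mem ⟨hr.lt₁₂.le, hr.lt₂₃.le⟩]; simp [cubic]
      linarith [hZ.sol.lt_mul_of_le_mul h₂ hu₁0 hzero he₂.le h, hγ.le]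
    · rw [h] at he₂
      linarith [hγ.le]
  refine isLUB_image_coe (fun τ hτ => ?_) fun c hc =>
    hγ.exists_lt_fst hr hZ.sol hu₀₁ (fun u hu => hrise u hu.2) hc
  by_contra! hlt'
  obtain ⟨u, -, hu, huv, hgu⟩ := hγ.exists_mul_eq hr hZ.sol hτ (hγ.le.trans he₂.le) hlt'.le he₃.le
  have hu0 : 0 < u := (pos_iff_pos_of_mul_pos (huv ▸ he0)).2 hu
  rcases lt_trichotomy u u₁ with h | rfl | h
  · have := hmono ⟨hu0.le, h.le⟩ ⟨hu₁0.le, le_rfl⟩ h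
    simp only at this
    linarith
  · exact absurd hg₁ (not_le.2 hgu)
  · linarith [hZ.sol.mul_lt_of_gain_nonpos hT hu₁0 he0 hg₁ h]

/-- If the left separatrix is above the right one, the rising arc crosses `v = r₃` and goes to
infinity. -/
theorem IsLeftSeparatrix.isLUB_of_gt (hr : IsRootTriple r₁ r₂ r₃)
    (hZ : IsLeftSeparatrix r₁ r₂ r₃ Z) (h0 : 0 < Z 0) (hgt : cubicThreshold r₁ r₂ r₃ < Z 0)
    (hγ : StartsOn r₁ r₂ r₃ Z γ E u₀) :
    IsLUB ((fun τ => ((γ τ).1 : EReal)) '' riseTimes (cubic r₁ r₂ r₃) γ E) ⊤ := by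
  have hT := isTruncated_clampedCubic hr
  obtain ⟨x, hx0, hx⟩ := hT.exists_le_mul_of_threshold_lt hZ.sol hgt
  have hcl : IsClosed (Icc 0 x ∩ (fun u => u * Z u) ⁻¹' Ici r₃) :=
    isClosed_Icc.inter (isClosed_Ici.preimage hZ.sol.continuous_mul)
  obtain ⟨u₁, ⟨hu₁, hv₁⟩, hmin⟩ := (isCompact_Icc.of_isClosed_subset hcl
    inter_subset_left).exists_isLeast ⟨x, ⟨hx0.le, le_rfl⟩, hx⟩
  simp only [mem_preimage, mem_Ici] at hv₁
  have hu₁0 : 0 < u₁ := hu₁.1.lt_of_ne (by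
    rintro rfl
    rw [zero_mul] at hv₁
    linarith [hr.pos])
  have hbefore : ∀ u, 0 < u → u < u₁ → u * Z u < r₃ := by
    intro u hu huu
    by_contra! hle
    exact absurd (hmin ⟨⟨hu.le, huu.le.trans hu₁.2⟩, hle⟩) (not_le.2 huu)
  have hv₁' : u₁ * Z u₁ = r₃ := by
    refine le_antisymm ?_ hv₁
    refine le_of_tendsto (x := 𝓝[<] u₁)
      (hZ.sol.continuous_mul.continuousAt.mono_left nhdsWithin_le_nhds) ?_
    filter_upwards [Ioo_mem_nhdsLT hu₁0] with u hu
    exact (hbefore u hu.1 hu.2).le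
  have hZ₁ : 0 < Z u₁ := (pos_iff_pos_of_mul_pos (hr.pos.trans_le hv₁)).1 hu₁0
  have hrise : ∀ u ≤ u₁, u ∈ risingSet r₁ r₂ r₃ Z := by
    intro u hu
    rcases le_or_gt u 0 with h | h
    · exact hZ.mem_risingSet_of_nonpos hr h0 h
    have hZu := hZ.pos_of_le hr hZ₁ hu
    have hv := mul_pos h hZu
    rcases hu.lt_or_eq with hlt | rfl
    · refine ⟨hZu, ⟨hr.neg.le.trans hv.le, (hbefore u h hlt).le⟩, ?_⟩
      by_contra! hg
      linarith [hZ.sol.mul_lt_of_gain_nonpos hT h hv hg hlt, hbefore u h hlt]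
    · refine ⟨hZu, ⟨hr.neg.le.trans hv.le, hv₁'.le⟩, ?_⟩
      rw [gain, hv₁', clampedCubic_of_ge hr le_rfl, mul_zero, add_zero]
      exact hZu
  have hu₀₁ : u₀ < u₁ := by
    by_contra! hle
    rcases hle.lt_or_eq with h | h
    · linarith [hZ.sol.lt_mul_of_le_mul hr.pos hu₁0 (hT.zero r₃ le_rfl) hv₁ h, hγ.le, hr.lt₂₃]
    · rw [h] at hv₁
      linarith [hγ.le, hr.lt₂₃]
  refine isLUB_image_coe_top fun c => ?_
  -- Beyond `r₃` the graph is continued by the solution for a wider window `[r₁, M]`.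
  set M := max c r₃ + 1 with hM
  have hMr : r₃ < M := (le_max_right c r₃).trans_lt (lt_add_one _)
  have hMc : c < M := (le_max_left c r₃).trans_lt (lt_add_one _)
  have hM₁ : r₁ ≤ M := (hr.lt₁₃.trans hMr).le
  obtain ⟨K, hK⟩ := exists_lipschitzWith_clamp (contDiff_cubic (r₁ := r₁) (r₂ := r₂) (r₃ := r₃)) hM₁
  obtain ⟨B, hB⟩ := exists_bound_clamp
    (contDiff_cubic (r₁ := r₁) (r₂ := r₂) (r₃ := r₃)).continuous hM₁
  obtain ⟨Y, hY, hY0⟩ := exists_isSol hK hB u₀ (Z u₀)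
  obtain ⟨L, hL⟩ := hY.exists_lipschitzWith hB
  have hYZ : ∀ u ∈ Icc u₀ u₁, Y u = Z u := by
    refine eqOn_Icc_of_hasDerivWithinAt (F := fun t y => clamp (cubic r₁ r₂ r₃) r₁ M (t * y))
      (s := univ) (K := K * (max |u₀| |u₁|).toNNReal) (fun t ht =>
        (lipschitz_scaled hK (abs_le_max_abs_abs ht.1 ht.2)).lipschitzOnWith)
      (fun t _ => (hY t).hasDerivWithinAt) (fun _ _ => trivial) (fun t ht => ?_)
      (fun _ _ => trivial) ⟨le_rfl, hu₀₁.le⟩ hY0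
    have hwin := (hrise t ht.2).2.1
    rw [clamp_of_mem ⟨hwin.1, hwin.2.trans hMr.le⟩, ← clampedCubic_of_mem hwin]
    exact (hZ.sol t).hasDerivWithinAt
  have hY₁ : Y u₁ = Z u₁ := hYZ u₁ ⟨hu₀₁.le, le_rfl⟩
  have hstay : ∀ u ≥ u₁, r₃ ≤ u * Y u := by
    intro u hu
    rcases hu.lt_or_eq with h | rfl
    · refine (hY.lt_mul_of_le_mul hr.pos hu₁0 ?_ (by rw [hY₁, hv₁']) h).le
      rw [clamp_of_mem ⟨hr.lt₁₃.le, hMr.le⟩]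
      simp [cubic]
    · rw [hY₁, hv₁']
  have hnonneg : ∀ u ≥ u₁, 0 ≤ clamp (cubic r₁ r₂ r₃) r₁ M (u * Y u) := fun u hu =>
    cubic_nonneg_of_le hr ((le_min hMr.le (hstay u hu)).trans (le_max_right _ _))
  have hYmono : MonotoneOn Y (Ici u₁) := by
    refine monotoneOn_of_deriv_nonneg (convex_Ici u₁) hY.continuous.continuousOn
      (fun u _ => (hY u).differentiableAt.differentiableWithinAt) fun u hu => ?_
    rw [(hY u).deriv]
    exact hnonneg u (interior_subset hu)
  have hYpos : ∀ u ≥ u₁, Z u₁ ≤ Y u := fun u hu => hY₁ ▸ hYmono self_mem_Ici hu hu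
  have hvmono : MonotoneOn (fun u => u * Y u) (Ici u₁) := fun u hu w hw huw =>
    mul_le_mul huw (hYmono hu hw huw) (hZ₁.le.trans (hYpos u hu))
      (hu₁0.le.trans hw)
  have hfar : u₁ ≤ max u₁ (M / Z u₁) := le_max_left _ _
  obtain ⟨u₂, hu₂, hv₂⟩ : M ∈ (fun u => u * Y u) '' Icc u₁ (max u₁ (M / Z u₁)) := by
    refine intermediate_value_Icc hfar hY.continuous_mul.continuousOn
      ⟨by simp only [hY₁, hv₁']; exact hMr.le, ?_⟩
    have h1 : M ≤ max u₁ (M / Z u₁) * Z u₁ := by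
      rw [← div_le_iff₀ hZ₁]; exact le_max_right _ _
    exact h1.trans (mul_le_mul_of_nonneg_left (hYpos _ hfar) (hu₁0.le.trans hfar))
  simp only at hv₂
  have hgood : ∀ u ∈ Icc u₀ u₂, 0 < Y u ∧ u * Y u ∈ Icc r₁ M ∧
      0 < Y u + u * cubic r₁ r₂ r₃ (u * Y u) := by
    intro u hu
    rcases le_or_gt u u₁ with h | h
    · obtain ⟨h1, h2, h3⟩ := hrise u h
      rw [hYZ u ⟨hu.1, h⟩, ← clampedCubic_of_mem h2]
      exact ⟨h1, ⟨h2.1, h2.2.trans hMr.le⟩, h3⟩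
    · have h1 := hZ₁.trans_le (hYpos u h.le)
      have h2 := hstay u h.le
      have h3 : u * Y u ≤ M := hv₂ ▸ hvmono h.le hu₂.1 hu.2
      refine ⟨h1, ⟨hr.lt₁₃.le.trans h2, h3⟩, ?_⟩
      have h4 := mul_nonneg (hu₁0.trans h).le (cubic_nonneg_of_le hr h2)
      linarith
  obtain ⟨τ, hτ, hv⟩ := hγ.max.exists_mem_riseTimes hL (by rw [hY0]; exact hγ.start)
    (hu₀₁.trans_le hu₂.1) (fun u hu => (hgood u hu).1)
    (fun u hu => by rw [← clamp_of_mem (k := cubic r₁ r₂ r₃) (hgood u hu).2.1]; exact hY u)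
    fun u hu => (hgood u hu).2.2
  exact ⟨τ, hτ, by rw [hv, hv₂]; exact hMc⟩

end

/-! ### The end of the rising arc in terms of the thresholds -/

section

variable {r₁ r₂ r₃ : ℝ}

/-- `e` is the supremum of `v` over the rising arc of every orbit that leaves the saddle `(r₁, 0)`
into the upper half plane and is still to the left of `r₂` at time `0`, with `v` increasing. -/
def IsRiseEnd (r₁ r₂ r₃ : ℝ) (e : EReal) : Prop :=
  ∀ γ E, IsMaximalSolution (planarField (cubic r₁ r₂ r₃)) γ E → 0 < (γ 0).2 → Iic 0 ⊆ E →
    Tendsto γ atBot (𝓝 (r₁, 0)) → (γ 0).1 ≤ r₂ → 0 < (planarField (cubic r₁ r₂ r₃) (γ 0)).1 →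
    (riseTimes (cubic r₁ r₂ r₃) γ E).Nonempty ∧
      IsLUB ((fun τ => ((γ τ).1 : EReal)) '' riseTimes (cubic r₁ r₂ r₃) γ E) e

theorem IsMaximalSolution.curve_Icc {F : ℝ × ℝ → ℝ × ℝ} {γ : ℝ → ℝ × ℝ} {E : Set ℝ}
    (hγ : IsMaximalSolution F γ E) (hE : Iic 0 ⊆ E) :
    ∀ τ ≤ 0, IsIntegralCurveOn γ (fun _ => F) (Icc τ 0) := by
  intro τ hτ
  have := hγ.curve τ (hE hτ)
  rwa [uIcc_of_ge hτ] at this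

theorem IsLeftSeparatrix.startsOn (hr : IsRootTriple r₁ r₂ r₃) {Z : ℝ → ℝ}
    (hZ : IsLeftSeparatrix r₁ r₂ r₃ Z) {γ : ℝ → ℝ × ℝ} {E : Set ℝ}
    (hγ : IsMaximalSolution (planarField (cubic r₁ r₂ r₃)) γ E) (hz : 0 < (γ 0).2)
    (hE : Iic 0 ⊆ E) (hlim : Tendsto γ atBot (𝓝 (r₁, 0))) (hv : (γ 0).1 ≤ r₂)
    (hs : 0 < (planarField (cubic r₁ r₂ r₃) (γ 0)).1) :
    StartsOn r₁ r₂ r₃ Z γ E ((γ 0).1 / (γ 0).2) := by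
  have hc := hγ.curve_Icc hE
  have hgraph := hZ.snd_eq hr hc hz hlim (hv.trans_lt hr.lt₂₃)
  have hpos : ∀ τ ≤ 0, 0 < (γ τ).2 := fun τ hτ =>
    snd_pos contDiff_cubic.continuous (hc τ hτ) ⟨hτ, le_rfl⟩ hz τ ⟨le_rfl, hτ⟩
  have hlow := lt_fst_of_tendsto hr hc hpos hlim 0 le_rfl
  have hmul : (γ 0).1 / (γ 0).2 * Z ((γ 0).1 / (γ 0).2) = (γ 0).1 := by
    rw [← hgraph, div_mul_cancel₀ _ hz.ne']
  refine ⟨hγ, Prod.ext hmul.symm hgraph, hgraph ▸ hz, by rwa [hmul], by rwa [hmul], ?_⟩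
  rw [gain, hmul, ← hgraph, clampedCubic_of_mem ⟨hlow.le, hv.trans hr.lt₂₃.le⟩]
  have h2 : (planarField (cubic r₁ r₂ r₃) (γ 0)).1 =
      (γ 0).2 * ((γ 0).2 + (γ 0).1 / (γ 0).2 * cubic r₁ r₂ r₃ (γ 0).1) := by
    simp only [planarField]
    field_simp
    ring
  rw [h2] at hs
  exact (pos_iff_pos_of_mul_pos hs).1 hz

/-- The end of the rising arc in terms of the two thresholds: the values at `u = 0` of the left and
of the right separatrix. -/
theorem exists_isRiseEnd (hr : IsRootTriple r₁ r₂ r₃) :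
    ∃ e : EReal, IsRiseEnd r₁ r₂ r₃ e ∧
      (0 < r₂ → 0 < cubicThreshold (-r₃) (-r₂) (-r₁)) ∧
      (cubicThreshold (-r₃) (-r₂) (-r₁) ≤ 0 → e = 0) ∧
      (0 < cubicThreshold (-r₃) (-r₂) (-r₁) →
        (cubicThreshold (-r₃) (-r₂) (-r₁) < cubicThreshold r₁ r₂ r₃ →
          ((max 0 r₂ : ℝ) : EReal) < e ∧ e < (r₃ : EReal)) ∧
        (cubicThreshold (-r₃) (-r₂) (-r₁) = cubicThreshold r₁ r₂ r₃ → e = (r₃ : EReal)) ∧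
        (cubicThreshold r₁ r₂ r₃ < cubicThreshold (-r₃) (-r₂) (-r₁) → e = ⊤)) := by
  obtain ⟨Z, hZ⟩ := exists_isLeftSeparatrix hr
  have hend : ∀ e : EReal, e ≠ ⊥ → (∀ γ E u₀, StartsOn r₁ r₂ r₃ Z γ E u₀ →
      IsLUB ((fun τ => ((γ τ).1 : EReal)) '' riseTimes (cubic r₁ r₂ r₃) γ E) e) →
      IsRiseEnd r₁ r₂ r₃ e := by
    intro e he h γ E hγ hz hE hlim hv hs
    have hL := h γ E _ (hZ.startsOn hr hγ hz hE hlim hv hs)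
    refine ⟨?_, hL⟩
    by_contra hne
    rw [not_nonempty_iff_eq_empty.1 hne, image_empty] at hL
    exact he (hL.unique isLUB_empty)
  rw [← hZ.eq_threshold]
  have hpos : 0 < r₂ → 0 < Z 0 := fun h₂ => hZ.pos hr h₂ 0
  rcases le_or_gt (Z 0) 0 with h0 | h0
  · exact ⟨(0 : ℝ), hend _ (EReal.coe_ne_bot _) fun γ E u₀ hγ => hZ.isLUB_of_nonpos hr h0 hγ, hpos,
      fun _ => EReal.coe_zero, fun h => absurd h (not_lt.2 h0)⟩
  rcases lt_trichotomy (Z 0) (cubicThreshold r₁ r₂ r₃) with h | h | h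
  · obtain ⟨e, he, he₃, hL⟩ := hZ.exists_isLUB_of_lt hr h0 h
    exact ⟨e, hend _ (EReal.coe_ne_bot _) hL, hpos, fun h' => absurd h0 (not_lt.2 h'), fun _ =>
      ⟨fun _ => ⟨EReal.coe_lt_coe_iff.2 he, EReal.coe_lt_coe_iff.2 he₃⟩, fun h' => absurd h' h.ne,
        fun h' => absurd h' h.not_gt⟩⟩
  · exact ⟨r₃, hend _ (EReal.coe_ne_bot _) fun γ E u₀ hγ => hZ.isLUB_of_eq hr h0 h hγ, hpos,
      fun h' => absurd h0 (not_lt.2 h'), fun _ => ⟨fun h' => absurd h h'.ne, fun _ => rfl,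
        fun h' => absurd h h'.ne'⟩⟩
  · exact ⟨⊤, hend _ top_ne_bot fun γ E u₀ hγ => hZ.isLUB_of_gt hr h0 h hγ, hpos,
      fun h' => absurd h0 (not_lt.2 h'), fun _ => ⟨fun h' => absurd h' h.not_gt,
        fun h' => absurd h' h.ne', fun _ => rfl⟩⟩

end

/-! ### Time reversal -/

section

variable {k : ℝ → ℝ} {γ : ℝ → ℝ × ℝ} {E s : Set ℝ}

/-- The curve `γ` run backwards in the mirror image `v ↦ -v`. -/
def reverse (γ : ℝ → ℝ × ℝ) (τ : ℝ) : ℝ × ℝ := (-(γ (-τ)).1, (γ (-τ)).2)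

theorem reverse_reverse (γ : ℝ → ℝ × ℝ) : reverse (reverse γ) = γ := by
  funext τ
  simp [reverse]

theorem neg_preimage_uIcc (τ : ℝ) : Neg.neg ⁻¹' uIcc 0 τ = uIcc 0 (-τ) := by
  ext x
  rcases le_total 0 τ with h | h
  · rw [uIcc_of_le h, uIcc_of_ge (neg_nonpos.2 h)]
    constructor <;> rintro ⟨h1, h2⟩ <;> constructor <;> linarith
  · rw [uIcc_of_ge h, uIcc_of_le (neg_nonneg.2 h)]
    constructor <;> rintro ⟨h1, h2⟩ <;> constructor <;> linarith

/-- Time reversal together with `v ↦ -v` turns the system of `k` into that of `v ↦ -k (-v)`. -/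
theorem isIntegralCurveOn_reverse (hγ : IsIntegralCurveOn γ (fun _ => planarField k) s) :
    IsIntegralCurveOn (reverse γ) (fun _ => planarField fun v => -k (-v)) (Neg.neg ⁻¹' s) := by
  intro t ht
  have hn : HasDerivWithinAt (Neg.neg : ℝ → ℝ) (-1) (Neg.neg ⁻¹' s) t :=
    (hasDerivAt_neg t).hasDerivWithinAt
  have h1 := ((hasDerivWithinAt_fst hγ ht).scomp t hn fun _ h => h).neg
  have h2 := (hasDerivWithinAt_snd hγ ht).scomp t hn fun _ h => h
  refine (h1.prodMk h2).congr_deriv (Prod.ext ?_ ?_)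
  · simp [planarField, reverse]
  · simp [planarField, reverse]

theorem isMaximalSolution_reverse (hγ : IsMaximalSolution (planarField k) γ E) :
    IsMaximalSolution (planarField fun v => -k (-v)) (reverse γ) (Neg.neg ⁻¹' E) where
  curve τ hτ := by
    have := isIntegralCurveOn_reverse (hγ.curve (-τ) hτ)
    rwa [neg_preimage_uIcc, neg_neg] at this
  maximal τ η h0 hη := by
    have h1 := isIntegralCurveOn_reverse hη
    simp only [neg_neg, neg_preimage_uIcc] at h1
    obtain ⟨hE, heq⟩ := hγ.maximal (-τ) (reverse η) (by
      simp [reverse, h0]) h1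
    refine ⟨hE, fun t ht => ?_⟩
    have ht' : -t ∈ uIcc 0 (-τ) := by
      rw [← neg_preimage_uIcc, mem_preimage, neg_neg]; exact ht
    have := heq ht'
    rw [← reverse_reverse η]
    simp only [reverse, neg_neg] at this ⊢
    rw [← this]
    simp

end

/-! ### Ends of the rising arc as limits -/

theorem neBot_comap_nhdsLT {B : EReal} (hB : ⊥ < B) :
    (comap (fun τ : ℝ => (τ : EReal)) (𝓝[<] B)).NeBot := by
  refine comap_neBot fun t ht => ?_
  obtain ⟨l, hl, hsub⟩ := (mem_nhdsLT_iff_exists_Ioo_subset' hB).1 ht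
  obtain ⟨x, h1, h2⟩ := EReal.lt_iff_exists_real_btwn.1 hl
  exact ⟨x, hsub ⟨h1, h2⟩⟩

theorem neBot_comap_nhdsGT {B : EReal} (hB : B < ⊤) :
    (comap (fun τ : ℝ => (τ : EReal)) (𝓝[>] B)).NeBot := by
  refine comap_neBot fun t ht => ?_
  obtain ⟨l, hl, hsub⟩ := (mem_nhdsGT_iff_exists_Ioo_subset' hB).1 ht
  obtain ⟨x, h1, h2⟩ := EReal.lt_iff_exists_real_btwn.1 hl
  exact ⟨x, hsub ⟨h1, h2⟩⟩

/-- The supremum of `v` over the rising arc is the limit of `v` at the end of the arc. -/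
theorem tendsto_of_isLUB {k : ℝ → ℝ} {γ : ℝ → ℝ × ℝ} {E : Set ℝ} {e : EReal}
    (hγ : IsMaximalSolution (planarField k) γ E) (hne : (riseTimes k γ E).Nonempty)
    (he : IsLUB ((fun τ => ((γ τ).1 : EReal)) '' riseTimes k γ E) e) :
    Tendsto (fun τ : ℝ => (((γ τ).1 : ℝ) : EReal)) (comap (fun τ : ℝ => (τ : EReal))
      (𝓝[<] sSup ((fun τ : ℝ => (τ : EReal)) '' riseTimes k γ E))) (𝓝 e) := by
  set B := sSup ((fun τ : ℝ => (τ : EReal)) '' riseTimes k γ E) with hB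
  have hdown : ∀ τ ∈ riseTimes k γ E, ∀ σ, 0 < σ → σ ≤ τ → σ ∈ riseTimes k γ E := by
    rintro τ ⟨h1, h2, h3⟩ σ hσ hστ
    have hsub : uIcc 0 σ ⊆ uIcc 0 τ := by
      rw [uIcc_of_le hσ.le, uIcc_of_le h1.le]; exact Icc_subset_Icc_right hστ
    exact ⟨hσ, (hγ.maximal σ γ rfl ((hγ.curve τ h2).mono hsub)).1,
      fun s hs => h3 s ⟨hs.1, hs.2.trans hστ⟩⟩
  have hmem : ∀ τ : ℝ, 0 < τ → (τ : EReal) < B → τ ∈ riseTimes k γ E := by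
    intro τ hτ hτB
    obtain ⟨_, ⟨σ, hσ, rfl⟩, hlt⟩ := lt_sSup_iff.1 hτB
    exact hdown σ hσ τ hτ (EReal.coe_lt_coe_iff.1 hlt).le
  have hnear : ∀ σ ∈ riseTimes k γ E, ∀ σ' < σ, ∀ᶠ τ : ℝ in
      comap (fun τ : ℝ => (τ : EReal)) (𝓝[<] B), σ' < τ ∧ (τ : EReal) < B := by
    intro σ hσ σ' hσ'
    have h1 : (σ' : EReal) < B := (EReal.coe_lt_coe_iff.2 hσ').trans_le (le_sSup ⟨σ, hσ, rfl⟩)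
    have h2 : Ioo (σ' : EReal) B ∈ 𝓝[<] B := Ioo_mem_nhdsLT h1
    filter_upwards [preimage_mem_comap h2] with τ hτ
    exact ⟨EReal.coe_lt_coe_iff.1 hτ.1, hτ.2⟩
  rw [tendsto_order]
  refine ⟨fun a ha => ?_, fun a ha => ?_⟩
  · obtain ⟨_, ⟨σ, hσ, rfl⟩, haσ⟩ := (lt_isLUB_iff he).1 ha
    have hc := hγ.curve σ hσ.2.1
    rw [uIcc_of_le hσ.1.le] at hc
    have hcont : Tendsto (fun t => (((γ t).1 : ℝ) : EReal)) (𝓝[<] σ) (𝓝 ((γ σ).1 : EReal)) := by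
      refine (continuous_coe_real_ereal.tendsto _).comp
        (((hasDerivWithinAt_fst hc ⟨hσ.1.le, le_rfl⟩).continuousWithinAt).mono_left ?_)
      exact nhdsWithin_le_of_mem (mem_of_superset (Ioo_mem_nhdsLT hσ.1) Ioo_subset_Icc_self)
    obtain ⟨σ', haσ', hσ'⟩ := ((hcont.eventually (lt_mem_nhds haσ)).and
      (Ioo_mem_nhdsLT hσ.1)).exists
    filter_upwards [hnear σ hσ σ' hσ'.2] with τ hτ
    have hτ0 : 0 < τ := hσ'.1.trans hτ.1
    have := (strictMonoOn_fst hγ (hmem τ hτ0 hτ.2)) ⟨hσ'.1.le, hτ.1.le⟩ ⟨hτ0.le, le_rfl⟩ hτ.1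
    exact haσ'.trans (EReal.coe_lt_coe_iff.2 this)
  · obtain ⟨σ, hσ⟩ := hne
    filter_upwards [hnear σ hσ 0 hσ.1] with τ hτ
    exact (he.1 ⟨τ, hmem τ hτ.1 hτ.2, rfl⟩).trans_lt ha

/-! ### The maximal solution of the Poincaré system -/

section

variable {α : ℝ} {p : ℝ × ℝ}

theorem contDiff_f (α : ℝ) : ContDiff ℝ 1 fun v => f v α := by
  unfold f
  fun_prop

theorem sol_zero (α : ℝ) (p : ℝ × ℝ) : sol α p 0 = p := by
  rw [sol]
  split_ifs with h
  · exact (Classical.choose_spec h).1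
  · rfl

/-- Every solution is a restriction of `sol`. -/
theorem sol_eqOn {η : ℝ → ℝ × ℝ} {τ : ℝ} (h0 : η 0 = p)
    (hη : IsIntegralCurveOn η (fun _ => field α) (uIcc 0 τ)) : EqOn η (sol α p) (uIcc 0 τ) := by
  intro s hs
  have hsub : uIcc 0 s ⊆ uIcc 0 τ := uIcc_subset_uIcc_left hs
  have hsE : s ∈ existenceInterval α p := ⟨η, h0, hη.mono hsub⟩
  rw [sol, dif_pos hsE]
  obtain ⟨h1, h2⟩ := Classical.choose_spec hsE
  exact eqOn_of_isIntegralCurveOn (contDiff_f α) (hη.mono hsub) h2 left_mem_uIcc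
    (h0.trans h1.symm) right_mem_uIcc

theorem isMaximalSolution_sol (α : ℝ) (p : ℝ × ℝ) :
    IsMaximalSolution (field α) (sol α p) (existenceInterval α p) where
  curve := by
    rintro τ ⟨η, h0, hη⟩ t ht
    have heq := sol_eqOn h0 hη
    have := (hη t ht).congr (fun s hs => (heq hs).symm) (heq ht).symm
    rwa [heq ht] at this
  maximal τ η h0 hη := by
    rw [sol_zero] at h0
    exact ⟨⟨η, h0, hη⟩, sol_eqOn h0 hη⟩

end

/-! ### Zeros of `f` and the endpoints of the two separatrices -/

section

variable {α r₁ r₂ r₃ : ℝ}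

/-- The condition on `α` says that the local maximum of `f(·, α)`, at `2α/3`, is positive. -/
theorem exists_factorization (hα : α < -3 / (4 : ℝ) ^ (1 / 3 : ℝ)) :
    ∃ r₁ r₂ r₃ : ℝ, r₁ < r₂ ∧ r₂ < 0 ∧ 0 < r₃ ∧ (fun v => f v α) = cubic r₁ r₂ r₃ := by
  have hc : ((4 : ℝ) ^ (1 / 3 : ℝ)) ^ 3 = 4 := by
    rw [← Real.rpow_natCast, ← Real.rpow_mul (by norm_num)]
    norm_num
  have hc0 : 0 < (4 : ℝ) ^ (1 / 3 : ℝ) := by positivity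
  set c := (4 : ℝ) ^ (1 / 3 : ℝ)
  have hα0 : α < 0 := hα.trans (div_neg_of_neg_of_pos (by norm_num) hc0)
  have hα3 : 27 < 4 * (-α) ^ 3 := by
    have h1 : 3 < -α * c := by
      rw [lt_div_iff₀ hc0] at hα
      linarith
    have h2 : (3 : ℝ) ^ 3 < (-α * c) ^ 3 := pow_lt_pow_left₀ h1 (by norm_num) (by norm_num)
    rw [mul_pow, hc] at h2
    linarith
  have hcont : Continuous fun v => f v α := (contDiff_f α).continuous
  have hA : f α α < 0 := by unfold f; nlinarith
  have hB : 0 < f (2 * α / 3) α := by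
    have : f (2 * α / 3) α = (4 * (-α) ^ 3 - 27) / 27 := by unfold f; ring
    rw [this]
    apply div_pos <;> linarith
  have hC : f 0 α < 0 := by norm_num [f]
  have hD : 0 < f 2 α := by unfold f; linarith
  obtain ⟨r₁, h₁, e₁⟩ := intermediate_value_Ioo (by linarith : α ≤ 2 * α / 3) hcont.continuousOn
    ⟨hA, hB⟩
  obtain ⟨r₂, h₂, e₂⟩ := intermediate_value_Ioo' (by linarith : 2 * α / 3 ≤ 0) hcont.continuousOn
    ⟨hC, hB⟩
  obtain ⟨r₃, h₃, e₃⟩ := intermediate_value_Ioo (by norm_num : (0 : ℝ) ≤ 2) hcont.continuousOn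
    ⟨hC, hD⟩
  have h₁₂ : r₁ < r₂ := h₁.2.trans h₂.1
  have h₂₃ : r₂ < r₃ := h₂.2.trans h₃.1
  refine ⟨r₁, r₂, r₃, h₁₂, h₂.2, h₃.1, ?_⟩
  simp only [f] at e₁ e₂ e₃
  -- Vieta's formulas, from the differences of the three equations.
  have s₁₂ : r₁ ^ 2 + r₁ * r₂ + r₂ ^ 2 - α * (r₁ + r₂) = 0 :=
    (mul_eq_zero.1 (by linear_combination e₁ - e₂ :
      (r₁ - r₂) * (r₁ ^ 2 + r₁ * r₂ + r₂ ^ 2 - α * (r₁ + r₂)) = 0)).resolve_left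
      (sub_ne_zero.2 h₁₂.ne)
  have s₁₃ : r₁ ^ 2 + r₁ * r₃ + r₃ ^ 2 - α * (r₁ + r₃) = 0 :=
    (mul_eq_zero.1 (by linear_combination e₁ - e₃ :
      (r₁ - r₃) * (r₁ ^ 2 + r₁ * r₃ + r₃ ^ 2 - α * (r₁ + r₃)) = 0)).resolve_left
      (sub_ne_zero.2 (h₁₂.trans h₂₃).ne)
  have hsum : r₁ + r₂ + r₃ - α = 0 :=
    (mul_eq_zero.1 (by linear_combination s₁₂ - s₁₃ :
      (r₂ - r₃) * (r₁ + r₂ + r₃ - α) = 0)).resolve_left (sub_ne_zero.2 h₂₃.ne)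
  have hα' : α = r₁ + r₂ + r₃ := by linarith
  subst hα'
  funext v
  unfold f cubic
  linear_combination (v - r₁) * s₁₂ + e₁

theorem roots_eq (hf : (fun v => f v α) = cubic r₁ r₂ r₃) : roots α = {r₁, r₂, r₃} := by
  ext v
  have := congrFun hf v
  simp only [roots, mem_ofPred_eq, mem_insert_iff, mem_singleton_iff]
  rw [this, cubic, mul_eq_zero, mul_eq_zero, sub_eq_zero, sub_eq_zero, sub_eq_zero, or_assoc]

theorem v1_eq (hr : IsRootTriple r₁ r₂ r₃) (hf : (fun v => f v α) = cubic r₁ r₂ r₃) :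
    v1 α = r₁ := by
  rw [v1, roots_eq hf]
  refine IsLeast.csInf_eq ⟨by simp, ?_⟩
  rintro x (rfl | rfl | rfl)
  exacts [le_rfl, hr.lt₁₂.le, hr.lt₁₃.le]

theorem v3_eq (hr : IsRootTriple r₁ r₂ r₃) (hf : (fun v => f v α) = cubic r₁ r₂ r₃) :
    v3 α = r₃ := by
  rw [v3, roots_eq hf]
  refine IsGreatest.csSup_eq ⟨by simp, ?_⟩
  rintro x (rfl | rfl | rfl)
  exacts [hr.lt₁₃.le, hr.lt₂₃.le, le_rfl]

theorem v2_eq (hr : IsRootTriple r₁ r₂ r₃) (hf : (fun v => f v α) = cubic r₁ r₂ r₃) :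
    v2 α = r₂ := by
  rw [v2, v3_eq hr hf, roots_eq hf]
  refine IsGreatest.csSup_eq ⟨⟨by simp, hr.lt₂₃.ne⟩, ?_⟩
  rintro x ⟨rfl | rfl | rfl, hx⟩
  exacts [hr.lt₁₂.le, le_rfl, absurd rfl hx]

theorem field_eq (hf : (fun v => f v α) = cubic r₁ r₂ r₃) :
    field α = planarField (cubic r₁ r₂ r₃) := by
  rw [← hf]
  rfl

theorem tauBar_eq (hf : (fun v => f v α) = cubic r₁ r₂ r₃) (p : ℝ × ℝ) :
    tauBar α p = sSup ((fun τ : ℝ => (τ : EReal)) ''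
      riseTimes (cubic r₁ r₂ r₃) (sol α p) (existenceInterval α p)) := by
  rw [← hf]
  rfl

/-- The right endpoint of `L⁻` is the end of the rising arc. -/
theorem isVMinus_iff_of_isRiseEnd (hr : IsRootTriple r₁ r₂ r₃)
    (hf : (fun v => f v α) = cubic r₁ r₂ r₃) {e e' : EReal} (he : IsRiseEnd r₁ r₂ r₃ e) :
    IsVMinus α e' ↔ e' = e := by
  have hmax := fun p => field_eq hf ▸ isMaximalSolution_sol α p
  have hrise : ∀ p ∈ D2 α ∩ Lminus α,
      (riseTimes (cubic r₁ r₂ r₃) (sol α p) (existenceInterval α p)).Nonempty ∧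
      IsForwardEnd α p e := by
    rintro p ⟨⟨hz, -, h2, hs⟩, -, hE, hlim⟩
    rw [P1, v1_eq hr hf] at hlim
    rw [v2_eq hr hf] at h2
    have hs' : 0 < (planarField (cubic r₁ r₂ r₃) (sol α p 0)).1 := by
      rw [sol_zero, ← hf]; exact hs
    obtain ⟨hne, hL⟩ := he _ _ (hmax p) (by rwa [sol_zero]) hE hlim
      (by rw [sol_zero]; exact h2.le) hs'
    refine ⟨hne, ?_⟩
    rw [IsForwardEnd, tauBar_eq hf]
    exact tendsto_of_isLUB (hmax p) hne hL
  have hne : (D2 α ∩ Lminus α).Nonempty := by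
    obtain ⟨Z, hZ⟩ := exists_isLeftSeparatrix hr
    obtain ⟨γ, hγ, hlim, hz, h1, h2, hs⟩ := hZ.exists_orbit hr
    rw [← field_eq hf] at hγ hs
    have hcurve : ∀ τ ≤ 0, IsIntegralCurveOn γ (fun _ => field α) (uIcc 0 τ) := fun τ hτ =>
      hγ.mono (by rw [uIcc_of_ge hτ]; exact fun x hx => hx.2)
    refine ⟨γ 0, ⟨hz, by rwa [v1_eq hr hf], by rwa [v2_eq hr hf], hs⟩, hz,
      fun τ hτ => ⟨γ, rfl, hcurve τ hτ⟩, ?_⟩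
    rw [P1, v1_eq hr hf]
    refine hlim.congr' ?_
    filter_upwards [eventually_le_atBot 0] with τ hτ
    exact sol_eqOn rfl (hcurve τ hτ) right_mem_uIcc
  constructor
  · rintro ⟨⟨p, hp⟩, hend⟩
    obtain ⟨⟨τ, hτ⟩, hlim⟩ := hrise p hp
    have : (comap (fun τ : ℝ => (τ : EReal)) (𝓝[<] tauBar α p)).NeBot := by
      refine neBot_comap_nhdsLT ((EReal.bot_lt_coe τ).trans_le ?_)
      rw [tauBar_eq hf]
      exact le_sSup ⟨τ, hτ, rfl⟩
    exact tendsto_nhds_unique (hend p hp) hlim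
  · rintro rfl
    exact ⟨hne, fun p hp => (hrise p hp).2⟩

theorem cubic_reflect (hf : (fun v => f v α) = cubic r₁ r₂ r₃) :
    cubic (-r₃) (-r₂) (-r₁) = fun v => -f (-v) α := by
  funext v
  rw [cubic_neg, ← hf]

/-- The falling times in the definition of `tauUnder` are the negatives of the rise times of the
reversed solution. -/
theorem tauUnder_eq (hf : (fun v => f v α) = cubic r₁ r₂ r₃) (p : ℝ × ℝ) :
    tauUnder α p = -sSup ((fun τ : ℝ => (τ : EReal)) ''
      riseTimes (cubic (-r₃) (-r₂) (-r₁)) (reverse (sol α p))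
        (Neg.neg ⁻¹' existenceInterval α p)) := by
  have hspeed : ∀ s, (planarField (cubic (-r₃) (-r₂) (-r₁)) (reverse (sol α p) s)).1 =
      speed α p (-s) := by
    intro s
    simp [planarField, reverse, speed, cubic_reflect hf]
  refine IsGLB.sInf_eq ⟨?_, fun b hb => ?_⟩
  · rintro _ ⟨τ, ⟨h1, h2, h3⟩, rfl⟩
    refine EReal.neg_le_of_neg_le
      (le_sSup ⟨-τ, ⟨neg_pos.2 h1, by simpa using h2, fun s hs => ?_⟩, ?_⟩)
    · rw [hspeed]
      exact h3 _ ⟨by linarith [hs.2], by linarith [hs.1]⟩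
    · exact EReal.coe_neg τ
  · refine EReal.le_neg_of_le_neg (sSup_le ?_)
    rintro _ ⟨τ, ⟨h1, h2, h3⟩, rfl⟩
    refine EReal.le_neg_of_le_neg ?_
    rw [← EReal.coe_neg]
    refine hb ⟨-τ, ⟨neg_lt_zero.2 h1, h2, fun s hs => ?_⟩, rfl⟩
    have := h3 (-s) ⟨by linarith [hs.2], by linarith [hs.1]⟩
    rwa [hspeed, neg_neg] at this

theorem tendsto_neg_comap_nhdsGT (B : EReal) :
    Tendsto (Neg.neg : ℝ → ℝ) (comap (fun τ : ℝ => (τ : EReal)) (𝓝[>] (-B)))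
      (comap (fun τ : ℝ => (τ : EReal)) (𝓝[<] B)) := by
  rw [tendsto_comap_iff]
  have h : Tendsto (fun x : EReal => -x) (𝓝[>] (-B)) (𝓝[<] B) := by
    refine tendsto_nhdsWithin_iff.2 ⟨?_, ?_⟩
    · have := (continuous_neg.tendsto (-B)).mono_left (nhdsWithin_le_nhds (s := Ioi (-B)))
      rwa [neg_neg] at this
    · filter_upwards [self_mem_nhdsWithin] with x hx
      exact EReal.neg_lt_comm.1 hx
  exact (h.comp tendsto_comap).congr fun τ => (EReal.coe_neg τ).symm

/-- The left endpoint of `L⁺` is, up to sign, the end of the rising arc of the reversed system. -/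
theorem isVPlus_iff_of_isRiseEnd (hr : IsRootTriple r₁ r₂ r₃)
    (hf : (fun v => f v α) = cubic r₁ r₂ r₃) {e e' : EReal}
    (he : IsRiseEnd (-r₃) (-r₂) (-r₁) e) : IsVPlus α e' ↔ e' = -e := by
  have hmax : ∀ p, IsMaximalSolution (planarField (cubic (-r₃) (-r₂) (-r₁)))
      (reverse (sol α p)) (Neg.neg ⁻¹' existenceInterval α p) := by
    intro p
    rw [cubic_reflect hf]
    exact isMaximalSolution_reverse (k := fun v => f v α) (isMaximalSolution_sol α p)
  have hrise : ∀ p ∈ D3 α ∩ Lplus α,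
      (riseTimes (cubic (-r₃) (-r₂) (-r₁)) (reverse (sol α p))
        (Neg.neg ⁻¹' existenceInterval α p)).Nonempty ∧ IsBackwardEnd α p (-e) := by
    rintro p ⟨⟨hz, h2, -, hs⟩, -, hE, hlim⟩
    rw [P3, v3_eq hr hf] at hlim
    rw [v2_eq hr hf] at h2
    have h0 : reverse (sol α p) 0 = (-p.1, p.2) := by simp [reverse, sol_zero]
    have hlim' : Tendsto (reverse (sol α p)) atBot (𝓝 (-r₃, 0)) := by
      have hcomp := hlim.comp tendsto_neg_atBot_atTop
      exact ((continuous_fst.tendsto _).comp hcomp).neg.prodMk_nhds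
        ((continuous_snd.tendsto _).comp hcomp)
    obtain ⟨hne, hL⟩ := he _ _ (hmax p) (by rw [h0]; exact hz)
      (fun τ hτ => hE (mem_Ici.2 (neg_nonneg.2 (mem_Iic.1 hτ)))) hlim'
      (by rw [h0]; exact neg_le_neg h2)
      (by
        rw [h0, cubic_reflect hf]
        simpa [planarField] using hs)
    refine ⟨hne, ?_⟩
    rw [IsBackwardEnd, tauUnder_eq hf]
    have := (continuous_neg.tendsto e).comp ((tendsto_of_isLUB (hmax p) hne hL).comp
      (tendsto_neg_comap_nhdsGT _))
    refine this.congr fun τ => ?_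
    simp [reverse]
  have hne : (D3 α ∩ Lplus α).Nonempty := by
    obtain ⟨Z, hZ⟩ := exists_isLeftSeparatrix hr.reflect
    obtain ⟨γ, hγ, hlim, hz, h1, h2, hs⟩ := hZ.exists_orbit hr.reflect
    have hfield : planarField (fun v => -cubic (-r₃) (-r₂) (-r₁) (-v)) = field α := by
      rw [field_eq hf]
      congr 1
      funext v
      rw [cubic_neg, neg_neg, neg_neg]
    have hγ' := isIntegralCurveOn_reverse hγ
    rw [hfield] at hγ'
    have hcurve : ∀ τ, 0 ≤ τ → IsIntegralCurveOn (reverse γ) (fun _ => field α) (uIcc 0 τ) :=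
      fun τ hτ => hγ'.mono (by
        rw [uIcc_of_le hτ]
        exact fun x hx => neg_nonpos.2 hx.1)
    have h0 : reverse γ 0 = (-(γ 0).1, (γ 0).2) := by simp [reverse]
    refine ⟨reverse γ 0, ⟨?_, ?_, ?_, ?_⟩, ?_, fun τ hτ => ⟨reverse γ, rfl, hcurve τ hτ⟩, ?_⟩
    · rwa [h0]
    · rw [h0, v2_eq hr hf]
      exact le_neg.2 h2.le
    · rw [h0, v3_eq hr hf]
      exact neg_lt.2 h1
    · rw [h0]
      rw [cubic_reflect hf] at hs
      simpa [planarField] using hs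
    · rwa [h0]
    · have hcomp := hlim.comp tendsto_neg_atTop_atBot
      have h3 : Tendsto (reverse γ) atTop (𝓝 (- -r₃, 0)) :=
        ((continuous_fst.tendsto _).comp hcomp).neg.prodMk_nhds
          ((continuous_snd.tendsto _).comp hcomp)
      rw [P3, v3_eq hr hf]
      rw [neg_neg] at h3
      refine h3.congr' ?_
      filter_upwards [eventually_ge_atTop 0] with τ hτ
      exact sol_eqOn rfl (hcurve τ hτ) right_mem_uIcc
  constructor
  · rintro ⟨⟨p, hp⟩, hend⟩
    obtain ⟨⟨τ, hτ⟩, hlim⟩ := hrise p hp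
    have : (comap (fun τ : ℝ => (τ : EReal)) (𝓝[>] tauUnder α p)).NeBot := by
      refine neBot_comap_nhdsGT (lt_of_le_of_lt ?_ (EReal.coe_lt_top (-τ)))
      rw [tauUnder_eq hf, EReal.coe_neg]
      exact EReal.neg_le_neg_iff.2 (le_sSup ⟨τ, hτ, rfl⟩)
    exact tendsto_nhds_unique (hend p hp) hlim
  · rintro rfl
    exact ⟨hne, fun p hp => (hrise p hp).2⟩

end

end PoincareSystem

end

theorem mainTheorem6 (α : ℝ) (hα : α < -3 / (4 : ℝ) ^ (1 / 3 : ℝ)) :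
    (∃! vm : EReal, PoincareSystem.IsVMinus α vm) ∧
    (∃! vp : EReal, PoincareSystem.IsVPlus α vp) ∧
    ∀ vm vp : EReal, PoincareSystem.IsVMinus α vm → PoincareSystem.IsVPlus α vp →
      ∃! i : Fin 4,
        ![vm = 0 ∧ vp = ⊥,
          (0 < vm ∧ vm < (PoincareSystem.v3 α : EReal)) ∧ vp = ⊥,
          vm = (PoincareSystem.v3 α : EReal) ∧ vp = (PoincareSystem.v1 α : EReal),
          vm = ⊤ ∧ (PoincareSystem.v1 α : EReal) < vp ∧ vp < (PoincareSystem.v2 α : EReal)] i := by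
  obtain ⟨r₁, r₂, r₃, h₁₂, h₂, h₃, hf⟩ := PoincareSystem.exists_factorization hα
  have hr : PoincareSystem.IsRootTriple r₁ r₂ r₃ :=
    ⟨h₁₂, h₂.trans h₃, h₁₂.trans h₂, h₃, h₂.ne⟩
  obtain ⟨e, he, -, hzero, hpos⟩ := PoincareSystem.exists_isRiseEnd hr
  obtain ⟨e', he', hpos₀, -, hpos'⟩ := PoincareSystem.exists_isRiseEnd hr.reflect
  simp only [neg_neg] at hpos₀ hpos'
  have hR := hpos₀ (neg_pos.2 h₂)
  have hm : ∀ x, PoincareSystem.IsVMinus α x ↔ x = e := fun x =>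
    PoincareSystem.isVMinus_iff_of_isRiseEnd hr hf he
  have hp : ∀ x, PoincareSystem.IsVPlus α x ↔ x = -e' := fun x =>
    PoincareSystem.isVPlus_iff_of_isRiseEnd hr hf he'
  refine ⟨⟨e, (hm e).2 rfl, fun x hx => (hm x).1 hx⟩,
    ⟨-e', (hp (-e')).2 rfl, fun x hx => (hp x).1 hx⟩, fun vm vp hvm hvp => ?_⟩
  obtain rfl := (hm vm).1 hvm
  obtain rfl := (hp vp).1 hvp
  rw [PoincareSystem.v1_eq hr hf, PoincareSystem.v2_eq hr hf, PoincareSystem.v3_eq hr hf]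
  have h₃' : (0 : EReal) < (r₃ : EReal) := EReal.coe_pos.2 h₃
  have hcases : (vm = 0 ∧ -e' = ⊥) ∨ ((0 < vm ∧ vm < (r₃ : EReal)) ∧ -e' = ⊥) ∨
      (vm = (r₃ : EReal) ∧ -e' = (r₁ : EReal)) ∨
      (vm = ⊤ ∧ (r₁ : EReal) < -e' ∧ -e' < (r₂ : EReal)) := by
    rcases le_or_gt (PoincareSystem.cubicThreshold (-r₃) (-r₂) (-r₁)) 0 with h0 | h0
    · have := (hpos' hR).2.2 (h0.trans_lt hR)
      exact Or.inl ⟨hzero h0, by rw [this, EReal.neg_top]⟩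
    rcases lt_trichotomy (PoincareSystem.cubicThreshold (-r₃) (-r₂) (-r₁))
      (PoincareSystem.cubicThreshold r₁ r₂ r₃) with h | h | h
    · have h1 := (hpos h0).1 h
      have h2 := (hpos' hR).2.2 h
      rw [max_eq_left h₂.le, EReal.coe_zero] at h1
      exact Or.inr (Or.inl ⟨h1, by rw [h2, EReal.neg_top]⟩)
    · have h1 := (hpos h0).2.1 h
      have h2 := (hpos' hR).2.1 h.symm
      exact Or.inr (Or.inr (Or.inl ⟨h1, by rw [h2, EReal.coe_neg, neg_neg]⟩))
    · have h1 := (hpos h0).2.2 h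
      have h2 := (hpos' hR).1 h
      rw [max_eq_right (neg_nonneg.2 h₂.le), EReal.coe_neg, EReal.coe_neg] at h2
      exact Or.inr (Or.inr (Or.inr ⟨h1, EReal.lt_neg_comm.1 h2.2, EReal.neg_lt_comm.1 h2.1⟩))
  -- The four conditions on the first endpoint exclude one another.
  rcases hcases with h | h | h | h
  · refine ⟨0, h, fun i hi => ?_⟩
    fin_cases i <;> simp_all
  · refine ⟨1, h, fun i hi => ?_⟩
    fin_cases i <;> simp_all
  · refine ⟨2, h, fun i hi => ?_⟩
    fin_cases i <;> simp_all
  · refine ⟨3, h, fun i hi => ?_⟩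
    fin_cases i <;> simp_all
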